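/- **First classification theorem.** Let $Y_t$ be a regular driftless diffusion without killing whose state space has as its interior a (bounded or unbounded) open interval $D\subseteq\mathbb R$, with generator $\mathcal L_Y f=\tfrac12\sigma_Y^2(y)f''(y)$, where $\sigma_Y$ is smooth and strictly positive on $D$. For real $a,b,w$ let $(K)$ be the scaled Kummer equation $xF''+(b-wx)F'-awF=0$ on $(0,\infty)$ (the equation of $M(a,b,wx)$ and $U(a,b,wx)$), with Wronskian $W(x)=x^{-b}e^{wx}$. For $\gamma\in\mathbb R$ and $\alpha,\beta\in\mathbb C$ with $\alpha+\beta$ and $\alpha\beta$ real let $(H)$ be the hypergeometric equation $x(1-x)F''+(\gamma-(1+\alpha+\beta)x)F'-\alpha\beta F=0$ on $(0,1)$ (the equation of ${}_2F_1(\alpha,\beta;\gamma;x)$), with Wronskian $W(x)=x^{-\gamma}(1-x)^{\gamma-\alpha-\beta-1}$. Solutions are understood to be real-valued and twice continuously differentiable. A change of variables is a smooth bijection between open intervals with nowhere vanishing derivative. Call $Y$ *solvable* if at least one of the following holds: there are a change of variables $y=y(z)$ from $(0,\infty)$ onto $D$, not depending on $\lambda$, and a nowhere vanishing function $h(z,\lambda)$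 such that, for every $\lambda\ge 0$, there are parameters $a,b,w$ (depending on $\lambda$) for which every solution $f$ of $\mathcal L_Yf=\lambda f$ on $D$ satisfies $f(y(z))=h(z,\lambda)F(z)$ with a solution $F$ of $(K)$; or the same holds with $(0,1)$, parameters $\alpha,\beta,\gamma$ and $(H)$ in place of $(0,\infty)$, $a,b,w$ and $(K)$. Then $Y$ is solvable if and only if its volatility function has the form $$\sigma_Y(Y(x))=C\sqrt{A(x)}\,\frac{W(x)}{(c_1F_1(x)+c_2F_2(x))^2}\sqrt{\frac{A(x)}{R(x)}},\qquad x\in I,$$ where $$y=Y(x)=\frac{c_3F_1(x)+c_4F_2(x)}{c_1F_1(x)+c_2F_2(x)},\qquad c_1c_4-c_3c_2\neq0,$$ is a change of variables from $I$ onto $D$ whose denominator $c_1F_1+c_2F_2$ has no zero in $I$, where $C,c_1,\dots,c_4$ are real constants and $R$ is a real polynomial of degree at most $2$ without zeros in $I$, and where one of the following two cases holds: * $A(x)=x$, $I=(0,\infty)$, $F_1,F_2$ are two linearly independent solutions of $(K)$ for some $a,b,w$ (for example $M(a,b,wx)$ and $U(a,b,wx)$ whenever $w>0$ and these are defined and independent),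 and $W$ is the Wronskian of $(K)$; * $A(x)=x(1-x)$, $I=(0,1)$, $F_1,F_2$ are two linearly independent solutions of $(H)$ for some $\alpha,\beta,\gamma$, and $W$ is the Wronskian of $(H)$. -/

import Mathlib

open Set
open scoped ContDiff

noncomputable section

/-- A regular driftless one-dimensional diffusion without killing, specified (in the interior `D` of
its state space, an arbitrary bounded or unbounded open interval) by its Markov generator
`(1/2) σ(y)² d²/dy²` with a smooth and strictly positive volatility function `σ`. -/
structure DriftlessDiffusion where
  /-- the interior of the state space -/
  D : Set ℝ
  isOpen_D : IsOpen D
  ordConnected_D : D.OrdConnected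
  nonempty_D : D.Nonempty
  /-- the volatility function -/
  σ : ℝ → ℝ
  smooth_σ : ContDiffOn ℝ ∞ σ D
  σ_pos : ∀ y ∈ D, 0 < σ y

/-- The generator `(1/2) σ(y)² d²/dy²`. -/
def DriftlessDiffusion.generator (Y : DriftlessDiffusion) (f : ℝ → ℝ) (y : ℝ) : ℝ :=
  1 / 2 * Y.σ y ^ 2 * deriv (deriv f) y

/-- `f` is a (classical) solution on `D` of the eigenfunction equation `ℒ f = lam • f`. -/
def DriftlessDiffusion.IsEigenfunction (Y : DriftlessDiffusion) (lam : ℝ) (f : ℝ → ℝ) : Prop :=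
  ContDiffOn ℝ 2 f Y.D ∧ ∀ y ∈ Y.D, Y.generator f y = lam * f y

/-- `F` is a solution on `(0, ∞)` of the scaled Kummer (confluent hypergeometric) equation
`x F'' + (b - w x) F' - a w F = 0`, the equation of `M(a, b, w x)` and `U(a, b, w x)`. -/
def IsScaledKummerSolution (a b w : ℝ) (F : ℝ → ℝ) : Prop :=
  ContDiffOn ℝ 2 F (Ioi 0) ∧
    ∀ x ∈ Ioi (0 : ℝ), x * deriv (deriv F) x + (b - w * x) * deriv F x - a * w * F x = 0

/-- The parameters `α, β` for which the hypergeometric equation (with real `γ`) has real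
coefficients: `α + β` and `α β` are real, that is, `α, β` are both real or complex conjugate. -/
def RealCoefficients (α β : ℂ) : Prop :=
  (α + β).im = 0 ∧ (α * β).im = 0

/-- `F` is a real solution on `(0, 1)` of the hypergeometric equation
`x (1 - x) F'' + (γ - (1 + α + β) x) F' - α β F = 0`, the equation of `₂F₁(α, β; γ; x)`.
It is used with `RealCoefficients α β` only, so that `(α + β).re = α + β`
and `(α * β).re = α * β`. -/
def IsHypergeometricSolution (α β : ℂ) (γ : ℝ) (F : ℝ → ℝ) : Prop :=
  ContDiffOn ℝ 2 F (Ioo 0 1) ∧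
    ∀ x ∈ Ioo (0 : ℝ) 1, x * (1 - x) * deriv (deriv F) x
      + (γ - (1 + (α + β).re) * x) * deriv F x - (α * β).re * F x = 0

/-- Linear independence, as functions on `I`. -/
def LinIndepOn (I : Set ℝ) (F₁ F₂ : ℝ → ℝ) : Prop :=
  ∀ u v : ℝ, (∀ x ∈ I, u * F₁ x + v * F₂ x = 0) → u = 0 ∧ v = 0

/-- `y = y(z)` is a change of variables from the open interval `I` onto `J`: a smooth bijection
with nowhere vanishing derivative (so its inverse `J → I` is smooth as well). -/
def IsChangeOfVariables (y : ℝ → ℝ) (I J : Set ℝ) : Prop :=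
  BijOn y I J ∧ ContDiffOn ℝ ∞ y I ∧ ∀ z ∈ I, deriv y z ≠ 0

/-- The diffusion is solvable in terms of scaled confluent hypergeometric functions: there are a
change of variables `y = y(z)` from `(0, ∞)` onto `D`, not depending on `lam`, and a gauge factor
`h z lam` such that, for every `lam ≥ 0`, all solutions of `ℒ f = lam • f` have the form
`f (y z) = h z lam * F z`, with `F` a scaled confluent hypergeometric function whose parameters
depend on `lam` only. -/
def DriftlessDiffusion.IsConfluentSolvable (Y : DriftlessDiffusion) : Prop :=
  ∃ (y : ℝ → ℝ) (h : ℝ → ℝ → ℝ), IsChangeOfVariables y (Ioi 0) Y.D ∧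
    ∀ lam : ℝ, 0 ≤ lam → (∀ z ∈ Ioi (0 : ℝ), h z lam ≠ 0) ∧
      ∃ a b w : ℝ, ∀ f : ℝ → ℝ, Y.IsEigenfunction lam f →
        ∃ F : ℝ → ℝ, IsScaledKummerSolution a b w F ∧
          ∀ z ∈ Ioi (0 : ℝ), f (y z) = h z lam * F z

/-- The same in terms of hypergeometric functions, with a change of variables from `(0, 1)`. -/
def DriftlessDiffusion.IsHypergeometricSolvable (Y : DriftlessDiffusion) : Prop :=
  ∃ (y : ℝ → ℝ) (h : ℝ → ℝ → ℝ), IsChangeOfVariables y (Ioo 0 1) Y.D ∧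
    ∀ lam : ℝ, 0 ≤ lam → (∀ z ∈ Ioo (0 : ℝ) 1, h z lam ≠ 0) ∧
      ∃ (α β : ℂ) (γ : ℝ), RealCoefficients α β ∧ ∀ f : ℝ → ℝ, Y.IsEigenfunction lam f →
        ∃ F : ℝ → ℝ, IsHypergeometricSolution α β γ F ∧
          ∀ z ∈ Ioo (0 : ℝ) 1, f (y z) = h z lam * F z

/-- Solvability: all solutions of `ℒ f = lam • f` are, up to a change of variables independent of
`lam` and a gauge factor, hypergeometric or scaled confluent hypergeometric functions. -/
def DriftlessDiffusion.IsSolvable (Y : DriftlessDiffusion) : Prop :=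
  Y.IsConfluentSolvable ∨ Y.IsHypergeometricSolvable

/-- The Wronskian `exp (-∫ (b - w x) / x)` of the scaled Kummer equation. -/
def kummerWronskian (b w x : ℝ) : ℝ := x ^ (-b) * Real.exp (w * x)

/-- The Wronskian `exp (-∫ (γ - (1 + α + β) x) / (x (1 - x)))` of the hypergeometric equation. -/
def hypergeometricWronskian (α β : ℂ) (γ x : ℝ) : ℝ :=
  x ^ (-γ) * (1 - x) ^ (γ - (α + β).re - 1)

/-- On the interval `I`, the diffusion has the volatility function
`σ(Y(x)) = C √A · W / (c₁F₁ + c₂F₂)² · √(A / R)` in the variable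
`y = Y(x) = (c₃F₁ + c₄F₂) / (c₁F₁ + c₂F₂)`, `c₁c₄ - c₃c₂ ≠ 0`, for some constants and some
polynomial `R` of degree at most two that has no zero in `I`. -/
def DriftlessDiffusion.HasVolatilityForm (Y : DriftlessDiffusion) (I : Set ℝ)
    (A W F₁ F₂ : ℝ → ℝ) : Prop :=
  ∃ (R : Polynomial ℝ) (C c₁ c₂ c₃ c₄ : ℝ),
    R.natDegree ≤ 2 ∧ (∀ x ∈ I, R.eval x ≠ 0) ∧ c₁ * c₄ - c₃ * c₂ ≠ 0 ∧
    (∀ x ∈ I, c₁ * F₁ x + c₂ * F₂ x ≠ 0) ∧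
    IsChangeOfVariables (fun x => (c₃ * F₁ x + c₄ * F₂ x) / (c₁ * F₁ x + c₂ * F₂ x)) I Y.D ∧
    ∀ x ∈ I, Y.σ ((c₃ * F₁ x + c₄ * F₂ x) / (c₁ * F₁ x + c₂ * F₂ x)) =
      C * √(A x) * (W x / (c₁ * F₁ x + c₂ * F₂ x) ^ 2) * √(A x / R.eval x)

end

/-!
The proof rests on Liouville's normal form. A gauge transformation `u = θ F` removes the first-order
term of `A F'' + B F' - m F = 0`, and two such equations are gauge equivalent exactly when their
Liouville invariants `-m A - (B' A - B A') / 2 - B² / 4` agree (`exists_hasDerivAt_gauge`). For the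
Kummer equation (`A = x`) and the hypergeometric equation (`A = x (1 - x)`) the invariant is a
polynomial of degree at most two. On the other side, the change of variables
`y' = k W / F₀²`, with `F₀` a solution without zeros of one such equation, together with the gauge
`u = F₀ · (f ∘ y)` turns `ℒ f = lam f` into this equation with its invariant lowered by
`2 lam A² (y')² / σ(y)²` (`exists_hasDerivAt_pullback`).

Necessity (`exists_hasVolatilityForm_of_gauge`). For `lam = 0` the eigenfunctions `1` and `y` show
that `y` is a quotient of two solutions, so that `y' = k W / F₀²` by Abel's identity. For `lam = 1`
there are a positive eigenfunction `f` on all of `D`, given by a Neumann series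
(`exists_pos_solution_deriv_two_eq_mul`), and a second one `f r` with `r' = 1 / f²`. Comparing
Wronskians identifies the logarithmic derivative of the gauge factor, hence
`2 A² (y')² / σ(y)²` is the difference `R` of two Liouville invariants, and solving for `σ` yields
the formula.

Sufficiency (`exists_gauge_of_volatility`). Conversely the formula makes `2 A² (y')² / σ(y)²` a
positive multiple `κ R` of `R`, and `R > 0` on the interval since `σ > 0`. What is left is to realize
the invariant of the given equation minus `lam κ R` as the invariant of an equation of the same type.
The constraints on such invariants are upper bounds for their values at the singular points (and for
the coefficient of `x²` in the Kummer case), which persist because `R ≥ 0` at the end points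
(`exists_kummer_parameters`, `exists_hypergeometric_parameters`). The only exception is the Kummer
equation with `w = 0` and `R` of degree one, where the eigenfunctions are Bessel functions of `√x`;
there the substitution `x = z²` leads to a Kummer equation with `w ≠ 0` for every `lam > 0`.
-/

/-! ### A positive solution of `f'' = q f` on the whole interval -/

/-- A primitive of a function that is continuous on an open interval. -/
theorem hasDerivAt_integral_of_continuousOn {D : Set ℝ} (hD : IsOpen D) (hc : D.OrdConnected)
    {g : ℝ → ℝ} (hg : ContinuousOn g D) {x₀ x : ℝ} (hx₀ : x₀ ∈ D) (hx : x ∈ D) :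
    HasDerivAt (fun t => ∫ s in x₀..t, g s) (g x) x :=
  intervalIntegral.integral_hasDerivAt_right
    ((hg.mono (hc.uIcc_subset hx₀ hx)).intervalIntegrable)
    (hg.stronglyMeasurableAtFilter hD x hx) (hg.continuousAt (hD.mem_nhds hx))

theorem abs_integral_le_pow_div_factorial {g : ℝ → ℝ} {M x₀ x : ℝ} {n : ℕ}
    (hg : ∀ t ∈ uIcc x₀ x, |g t| ≤ M * ((M * |t - x₀|) ^ n / n.factorial)) :
    |∫ t in x₀..x, g t| ≤ (M * |x - x₀|) ^ (n + 1) / (n + 1).factorial := by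
  have hint : MeasureTheory.IntegrableOn
      (fun t => M * ((M * |t - x₀|) ^ n / n.factorial)) (uIoc x₀ x) := by
    rw [← intervalIntegrable_iff]
    apply Continuous.intervalIntegrable
    fun_prop
  have h1 : ‖∫ t in x₀..x, g t‖ ≤ ∫ t in uIoc x₀ x, M * ((M * |t - x₀|) ^ n / n.factorial) := by
    rw [intervalIntegral.norm_integral_eq_norm_integral_uIoc]
    refine MeasureTheory.norm_integral_le_of_norm_le hint ?_
    refine (MeasureTheory.ae_restrict_iff' measurableSet_uIoc).2 (Filter.Eventually.of_forall ?_)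
    intro t ht
    exact hg t (uIoc_subset_uIcc ht)
  have h2 : ∫ t in uIoc x₀ x, M * ((M * |t - x₀|) ^ n / n.factorial)
      = (M * |x - x₀|) ^ (n + 1) / (n + 1).factorial := by
    have : ∀ t, M * ((M * |t - x₀|) ^ n / n.factorial)
        = (M ^ (n + 1) / n.factorial) * |t - x₀| ^ n := fun t => by
      rw [mul_pow]; ring
    simp_rw [this]
    rw [MeasureTheory.integral_const_mul, integral_pow_abs_sub_uIoc, mul_pow, Nat.factorial_succ]
    push_cast
    field_simp
  rw [h2] at h1
  exact h1

/-- The terms of the Neumann series of the initial value problem `f'' = q f`, `f x₀ = 1`,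
`f' x₀ = 0`: the iterates of `u ↦ ∫∫ q u` on the constant `1`. -/
noncomputable def neumannTerm (q : ℝ → ℝ) (x₀ : ℝ) : ℕ → ℝ → ℝ
  | 0 => fun _ => 1
  | n + 1 => fun x => ∫ s in x₀..x, ∫ t in x₀..s, q t * neumannTerm q x₀ n t

section
variable {D : Set ℝ} {q : ℝ → ℝ} {x₀ : ℝ}

theorem continuousOn_neumannTerm (hD : IsOpen D) (hc : D.OrdConnected) (hq : ContinuousOn q D)
    (hx₀ : x₀ ∈ D) (n : ℕ) : ContinuousOn (neumannTerm q x₀ n) D := by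
  induction n with
  | zero => exact continuousOn_const
  | succ n ih =>
    have h1 : ContinuousOn (fun s => ∫ t in x₀..s, q t * neumannTerm q x₀ n t) D := fun s hs =>
      (hasDerivAt_integral_of_continuousOn hD hc (hq.mul ih) hx₀ hs).continuousAt.continuousWithinAt
    exact fun s hs =>
      (hasDerivAt_integral_of_continuousOn hD hc h1 hx₀ hs).continuousAt.continuousWithinAt

theorem hasDerivAt_integral_neumannTerm (hD : IsOpen D) (hc : D.OrdConnected)
    (hq : ContinuousOn q D) (hx₀ : x₀ ∈ D) (n : ℕ) {x : ℝ} (hx : x ∈ D) :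
    HasDerivAt (fun s => ∫ t in x₀..s, q t * neumannTerm q x₀ n t)
      (q x * neumannTerm q x₀ n x) x :=
  hasDerivAt_integral_of_continuousOn hD hc
    (hq.mul (continuousOn_neumannTerm hD hc hq hx₀ n)) hx₀ hx

theorem hasDerivAt_neumannTerm_succ (hD : IsOpen D) (hc : D.OrdConnected)
    (hq : ContinuousOn q D) (hx₀ : x₀ ∈ D) (n : ℕ) {x : ℝ} (hx : x ∈ D) :
    HasDerivAt (neumannTerm q x₀ (n + 1)) (∫ t in x₀..x, q t * neumannTerm q x₀ n t) x :=
  hasDerivAt_integral_of_continuousOn (g := fun s => ∫ t in x₀..s, q t * neumannTerm q x₀ n t)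
    hD hc (fun _ hs =>
      (hasDerivAt_integral_neumannTerm hD hc hq hx₀ n hs).continuousAt.continuousWithinAt) hx₀ hx

theorem neumannTerm_nonneg (hc : D.OrdConnected) (hq : ∀ x ∈ D, 0 ≤ q x) (hx₀ : x₀ ∈ D) (n : ℕ)
    {x : ℝ} (hx : x ∈ D) : 0 ≤ neumannTerm q x₀ n x := by
  induction n generalizing x with
  | zero => exact zero_le_one
  | succ n ih =>
    change 0 ≤ ∫ s in x₀..x, ∫ t in x₀..s, q t * neumannTerm q x₀ n t
    rcases le_total x₀ x with h | h
    · refine intervalIntegral.integral_nonneg h fun s hs => ?_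
      refine intervalIntegral.integral_nonneg hs.1 fun t ht => ?_
      have : t ∈ D := hc.out hx₀ hx ⟨ht.1, ht.2.trans hs.2⟩
      exact mul_nonneg (hq t this) (ih this)
    · rw [intervalIntegral.integral_symm, ← intervalIntegral.integral_neg]
      refine intervalIntegral.integral_nonneg h fun s hs => ?_
      rw [intervalIntegral.integral_symm, neg_neg]
      refine intervalIntegral.integral_nonneg hs.2 fun t ht => ?_
      have : t ∈ D := hc.out hx hx₀ ⟨hs.1.trans ht.1, ht.2⟩
      exact mul_nonneg (hq t this) (ih this)

/-- On an interval where `q` is bounded by `M`, the terms of the Neumann series and their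
derivatives are dominated by the terms of the series of `exp (M |x - x₀|)`. -/
theorem abs_neumannTerm_le {a b M : ℝ} (hM : 1 ≤ M) (hqM : ∀ x ∈ Icc a b, |q x| ≤ M)
    (hx₀ : x₀ ∈ Icc a b) (n : ℕ) :
    (∀ x ∈ Icc a b, |neumannTerm q x₀ n x| ≤ (M * |x - x₀|) ^ (2 * n) / (2 * n).factorial) ∧
    ∀ x ∈ Icc a b, |∫ t in x₀..x, q t * neumannTerm q x₀ n t|
      ≤ (M * |x - x₀|) ^ (2 * n + 1) / (2 * n + 1).factorial := by
  have hM0 : 0 ≤ M := zero_le_one.trans hM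
  have key : ∀ n, (∀ x ∈ Icc a b,
      |neumannTerm q x₀ n x| ≤ (M * |x - x₀|) ^ (2 * n) / (2 * n).factorial) →
      ∀ x ∈ Icc a b, |∫ t in x₀..x, q t * neumannTerm q x₀ n t|
        ≤ (M * |x - x₀|) ^ (2 * n + 1) / (2 * n + 1).factorial := by
    intro n h x hx
    refine abs_integral_le_pow_div_factorial fun t ht => ?_
    have ht' : t ∈ Icc a b := ordConnected_Icc.uIcc_subset hx₀ hx ht
    rw [abs_mul]
    exact mul_le_mul (hqM t ht') (h t ht') (abs_nonneg _) hM0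
  induction n with
  | zero =>
    have h0 : ∀ x ∈ Icc a b,
        |neumannTerm q x₀ 0 x| ≤ (M * |x - x₀|) ^ (2 * 0) / (2 * 0).factorial := by
      intro x _; simp [neumannTerm]
    exact ⟨h0, key 0 h0⟩
  | succ n ih =>
    have h1 : ∀ x ∈ Icc a b, |neumannTerm q x₀ (n + 1) x|
        ≤ (M * |x - x₀|) ^ (2 * (n + 1)) / (2 * (n + 1)).factorial := by
      intro x hx
      refine abs_integral_le_pow_div_factorial (n := 2 * n + 1) fun t ht => ?_
      have ht' : t ∈ Icc a b := ordConnected_Icc.uIcc_subset hx₀ hx ht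
      refine (ih.2 t ht').trans ?_
      exact le_mul_of_one_le_left (by positivity) hM
    exact ⟨h1, key _ h1⟩

/-- A linear equation `f'' = q f` with `q ≥ 0` continuous on an open interval has a positive
solution on the whole interval. -/
theorem exists_pos_solution_deriv_two_eq_mul (hD : IsOpen D) (hc : D.OrdConnected)
    (hne : D.Nonempty) (hq : ContinuousOn q D) (hq0 : ∀ x ∈ D, 0 ≤ q x) :
    ∃ f g : ℝ → ℝ, (∀ x ∈ D, 0 < f x) ∧ (∀ x ∈ D, HasDerivAt f (g x) x) ∧
      ∀ x ∈ D, HasDerivAt g (q x * f x) x := by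
  obtain ⟨x₀, hx₀⟩ := hne
  have main : ∀ x ∈ D, Summable (fun n => neumannTerm q x₀ n x) ∧
      HasDerivAt (fun x => ∑' n, neumannTerm q x₀ n x)
        (∑' n, ∫ t in x₀..x, q t * neumannTerm q x₀ n t) x ∧
      HasDerivAt (fun x => ∑' n, ∫ t in x₀..x, q t * neumannTerm q x₀ n t)
        (q x * ∑' n, neumannTerm q x₀ n x) x := by
    intro x hx
    obtain ⟨ε, hε, hεD⟩ := Metric.isOpen_iff.1 hD (min x x₀) (by
      rcases min_choice x x₀ with h | h <;> rw [h] <;> assumption)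
    obtain ⟨δ, hδ, hδD⟩ := Metric.isOpen_iff.1 hD (max x x₀) (by
      rcases max_choice x x₀ with h | h <;> rw [h] <;> assumption)
    set a := min x x₀ - ε / 2 with ha
    set b := max x x₀ + δ / 2 with hb
    have haD : a ∈ D := hεD (by rw [Metric.mem_ball, Real.dist_eq, abs_lt]; constructor <;> linarith)
    have hbD : b ∈ D := hδD (by rw [Metric.mem_ball, Real.dist_eq, abs_lt]; constructor <;> linarith)
    have hxab : x ∈ Ioo a b :=
      ⟨by linarith [min_le_left x x₀], by linarith [le_max_left x x₀]⟩
    have hx₀ab : x₀ ∈ Ioo a b :=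
      ⟨by linarith [min_le_right x x₀], by linarith [le_max_right x x₀]⟩
    have hsub : Icc a b ⊆ D := hc.out haD hbD
    obtain ⟨M₁, hM₁⟩ := isCompact_Icc.exists_bound_of_continuousOn (hq.mono hsub)
    set M := max 1 M₁
    have hM : 1 ≤ M := le_max_left _ _
    have hqM : ∀ x ∈ Icc a b, |q x| ≤ M := fun x hx => (hM₁ x hx).trans (le_max_right _ _)
    have hbd := abs_neumannTerm_le hM hqM (Ioo_subset_Icc_self hx₀ab)
    set r := M * (b - a)
    have hle : ∀ t ∈ Ioo a b, ∀ k : ℕ,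
        (M * |t - x₀|) ^ k / k.factorial ≤ r ^ k / k.factorial := by
      intro t ht k
      have : |t - x₀| ≤ b - a := by
        rw [abs_le]; constructor <;> linarith [ht.1, ht.2, hx₀ab.1, hx₀ab.2]
      have : M * |t - x₀| ≤ r := mul_le_mul_of_nonneg_left this (by linarith)
      gcongr
    have hev : Summable fun n : ℕ => r ^ (2 * n) / (2 * n).factorial :=
      (Real.summable_pow_div_factorial r).comp_injective (mul_right_injective₀ two_ne_zero)
    have hodd : Summable fun n : ℕ => r ^ (2 * n + 1) / (2 * n + 1).factorial :=
      (Real.summable_pow_div_factorial r).comp_injective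
        ((add_left_injective 1).comp (mul_right_injective₀ two_ne_zero))
    have hu : ∀ n, ∀ t ∈ Ioo a b, ‖neumannTerm q x₀ n t‖ ≤ r ^ (2 * n) / (2 * n).factorial :=
      fun n t ht => ((hbd n).1 t (Ioo_subset_Icc_self ht)).trans (hle t ht _)
    have hv : ∀ n, ∀ t ∈ Ioo a b, ‖∫ s in x₀..t, q s * neumannTerm q x₀ n s‖
        ≤ r ^ (2 * n + 1) / (2 * n + 1).factorial :=
      fun n t ht => ((hbd n).2 t (Ioo_subset_Icc_self ht)).trans (hle t ht _)
    have hsu : ∀ t ∈ Ioo a b, Summable fun n => neumannTerm q x₀ n t := fun t ht =>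
      Summable.of_norm_bounded hev fun n => hu n t ht
    have hsv : ∀ t ∈ Ioo a b, Summable fun n => ∫ s in x₀..t, q s * neumannTerm q x₀ n s :=
      fun t ht => Summable.of_norm_bounded hodd fun n => hv n t ht
    have hd1 : HasDerivAt (fun x => ∑' n, neumannTerm q x₀ (n + 1) x)
        (∑' n, ∫ t in x₀..x, q t * neumannTerm q x₀ n t) x :=
      hasDerivAt_tsum_of_isPreconnected hodd isOpen_Ioo isPreconnected_Ioo
        (fun n t ht => hasDerivAt_neumannTerm_succ hD hc hq hx₀ n
          (hsub (Ioo_subset_Icc_self ht))) hv hxab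
        ((summable_nat_add_iff 1).2 (hsu x hxab)) hxab
    refine ⟨hsu x hxab, ?_, ?_⟩
    · refine (hd1.const_add 1).congr_of_eventuallyEq ?_
      filter_upwards [isOpen_Ioo.mem_nhds hxab] with t ht
      rw [(hsu t ht).tsum_eq_zero_add]
      rfl
    · rw [← tsum_mul_left]
      refine hasDerivAt_tsum_of_isPreconnected (hev.mul_left M) isOpen_Ioo isPreconnected_Ioo
        (fun n t ht => hasDerivAt_integral_neumannTerm hD hc hq hx₀ n
          (hsub (Ioo_subset_Icc_self ht))) ?_ hxab (hsv x hxab) hxab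
      intro n t ht
      rw [norm_mul]
      exact mul_le_mul (hqM t (Ioo_subset_Icc_self ht)) (hu n t ht) (norm_nonneg _) (by linarith)
  refine ⟨fun x => ∑' n, neumannTerm q x₀ n x,
    fun x => ∑' n, ∫ t in x₀..x, q t * neumannTerm q x₀ n t, fun x hx => ?_,
    fun x hx => (main x hx).2.1, fun x hx => (main x hx).2.2⟩
  exact (main x hx).1.tsum_pos (fun n => neumannTerm_nonneg hc hq0 hx₀ n hx) 0 zero_lt_one

end

/-! ### Equations with polynomial coefficients and the Liouville invariant -/

/-- `F` is a real solution on `I` of the equation `A F'' + B F' - m F = 0` with polynomial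
coefficients `A`, `B` and a constant `m`. -/
def IsSolutionOn (I : Set ℝ) (A B : Polynomial ℝ) (m : ℝ) (F : ℝ → ℝ) : Prop :=
  ContDiffOn ℝ 2 F I ∧
    ∀ x ∈ I, A.eval x * deriv (deriv F) x + B.eval x * deriv F x - m * F x = 0

/-- `W` is a positive Wronskian function on `I` of the equation `A F'' + B F' - m F = 0`, that is,
a positive solution of `A W' + B W = 0`. -/
def IsWronskianOn (I : Set ℝ) (A B : Polynomial ℝ) (W : ℝ → ℝ) : Prop :=
  ∀ x ∈ I, 0 < W x ∧ HasDerivAt W (-(B.eval x / A.eval x) * W x) x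

/-- The Liouville invariant `-m A - (B' A - B A') / 2 - B² / 4`: the gauge factor that removes the
first-order term from `A F'' + B F' - m F = 0` leads to `A² v'' + (invariant) v = 0`. -/
noncomputable def liouvilleInvariant (A B : Polynomial ℝ) (m : ℝ) : Polynomial ℝ :=
  -Polynomial.C m * A - Polynomial.C (1 / 2) * (B.derivative * A - B * A.derivative)
    - Polynomial.C (1 / 4) * B ^ 2

theorem liouvilleInvariant_eval (A B : Polynomial ℝ) (m x : ℝ) :
    (liouvilleInvariant A B m).eval x = -m * A.eval x
      - 1 / 2 * (B.derivative.eval x * A.eval x - B.eval x * A.derivative.eval x)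
      - 1 / 4 * B.eval x ^ 2 := by
  simp [liouvilleInvariant]

theorem natDegree_liouvilleInvariant_le {A B : Polynomial ℝ} (hA : A.natDegree ≤ 2)
    (hB : B.natDegree ≤ 1) (m : ℝ) : (liouvilleInvariant A B m).natDegree ≤ 2 := by
  have hA' : A.derivative.natDegree ≤ 1 := (Polynomial.natDegree_derivative_le A).trans (by omega)
  have hB' : B.derivative.natDegree ≤ 0 := (Polynomial.natDegree_derivative_le B).trans (by omega)
  have h1 : (-Polynomial.C m * A).natDegree ≤ 2 := by
    rw [← Polynomial.C_neg]
    exact (Polynomial.natDegree_C_mul_le _ _).trans hA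
  have h2 : (Polynomial.C (1 / 2 : ℝ) * (B.derivative * A - B * A.derivative)).natDegree ≤ 2 := by
    refine (Polynomial.natDegree_C_mul_le _ _).trans
      ((Polynomial.natDegree_sub_le _ _).trans (max_le ?_ ?_))
    · exact Polynomial.natDegree_mul_le_of_le (m := 0) (n := 2) hB' hA
    · exact Polynomial.natDegree_mul_le_of_le (m := 1) (n := 1) hB hA'
  have h3 : (Polynomial.C (1 / 4 : ℝ) * B ^ 2).natDegree ≤ 2 :=
    (Polynomial.natDegree_C_mul_le _ _).trans (Polynomial.natDegree_pow_le_of_le 2 hB)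
  exact (Polynomial.natDegree_sub_le _ _).trans
    (max_le ((Polynomial.natDegree_sub_le _ _).trans (max_le h1 h2)) h3)

section Calculus

variable {I : Set ℝ} {F G H : ℝ → ℝ}

theorem ContDiffOn.hasDerivAt_deriv (hI : IsOpen I) (hF : ContDiffOn ℝ 2 F I) {x : ℝ}
    (hx : x ∈ I) :
    HasDerivAt F (deriv F x) x ∧ HasDerivAt (deriv F) (deriv (deriv F) x) x := by
  have hF' : ContDiffOn ℝ (1 + 1) F I := by simpa [one_add_one_eq_two] using hF
  obtain ⟨h1, -, h2⟩ := (contDiffOn_succ_iff_deriv_of_isOpen hI).1 hF'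
  exact ⟨(h1.differentiableAt (hI.mem_nhds hx)).hasDerivAt,
    ((h2.differentiableOn one_ne_zero).differentiableAt (hI.mem_nhds hx)).hasDerivAt⟩

theorem deriv_deriv_eq_of_hasDerivAt (hI : IsOpen I) (h1 : ∀ x ∈ I, HasDerivAt F (G x) x)
    (h2 : ∀ x ∈ I, HasDerivAt G (H x) x) {x : ℝ} (hx : x ∈ I) : deriv (deriv F) x = H x := by
  have : deriv F =ᶠ[nhds x] G := by
    filter_upwards [hI.mem_nhds hx] with t ht using (h1 t ht).deriv
  rw [this.deriv_eq]
  exact (h2 x hx).deriv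

theorem contDiffOn_two_of_hasDerivAt (hI : IsOpen I) (h1 : ∀ x ∈ I, HasDerivAt F (G x) x)
    (h2 : ∀ x ∈ I, HasDerivAt G (H x) x) (hH : ContinuousOn H I) : ContDiffOn ℝ 2 F I := by
  have hG : ContDiffOn ℝ (0 + 1) G I := by
    refine (contDiffOn_succ_iff_deriv_of_isOpen hI).2
      ⟨fun x hx => (h2 x hx).differentiableAt.differentiableWithinAt, by simp, ?_⟩
    exact contDiffOn_zero.2 (hH.congr fun x hx => (h2 x hx).deriv)
  have hF : ContDiffOn ℝ (1 + 1) F I := by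
    refine (contDiffOn_succ_iff_deriv_of_isOpen hI).2
      ⟨fun x hx => (h1 x hx).differentiableAt.differentiableWithinAt, by simp, ?_⟩
    rw [zero_add] at hG
    exact hG.congr fun x hx => (h1 x hx).deriv
  simpa [one_add_one_eq_two] using hF

theorem eqOn_of_hasDerivAt_of_eqOn (hI : IsOpen I) {u v u' v' : ℝ → ℝ} (huv : EqOn u v I)
    (hu : ∀ x ∈ I, HasDerivAt u (u' x) x) (hv : ∀ x ∈ I, HasDerivAt v (v' x) x) :
    EqOn u' v' I := fun x hx =>
  (hu x hx).unique ((hv x hx).congr_of_eventuallyEq (huv.eventuallyEq_of_mem (hI.mem_nhds hx)))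

end Calculus

/-! ### Solutions, Wronskians, and gauge transformations -/

theorem IsSolutionOn.of_hasDerivAt {I : Set ℝ} {A B : Polynomial ℝ} {m : ℝ} {F G H : ℝ → ℝ}
    (hI : IsOpen I) (hA : ∀ x ∈ I, 0 < A.eval x) (h1 : ∀ x ∈ I, HasDerivAt F (G x) x)
    (h2 : ∀ x ∈ I, HasDerivAt G (H x) x)
    (heq : ∀ x ∈ I, A.eval x * H x + B.eval x * G x - m * F x = 0) : IsSolutionOn I A B m F := by
  have cF : ContinuousOn F I := fun x hx => (h1 x hx).continuousAt.continuousWithinAt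
  have cG : ContinuousOn G I := fun x hx => (h2 x hx).continuousAt.continuousWithinAt
  have cH : ContinuousOn H I := by
    have : ContinuousOn (fun x => (m * F x - B.eval x * G x) / A.eval x) I :=
      ((continuousOn_const.mul cF).sub (B.continuous.continuousOn.mul cG)).div
        A.continuous.continuousOn fun x hx => (hA x hx).ne'
    refine this.congr fun x hx => ?_
    rw [eq_div_iff (hA x hx).ne']
    linear_combination heq x hx
  refine ⟨contDiffOn_two_of_hasDerivAt hI h1 h2 cH, fun x hx => ?_⟩
  rw [deriv_deriv_eq_of_hasDerivAt hI h1 h2 hx, (h1 x hx).deriv]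
  exact heq x hx

theorem IsSolutionOn.linear_combination {I : Set ℝ} {A B : Polynomial ℝ} {m : ℝ} {F₁ F₂ : ℝ → ℝ}
    (hI : IsOpen I) (hA : ∀ x ∈ I, 0 < A.eval x) (h₁ : IsSolutionOn I A B m F₁)
    (h₂ : IsSolutionOn I A B m F₂) (c₁ c₂ : ℝ) :
    IsSolutionOn I A B m (fun x => c₁ * F₁ x + c₂ * F₂ x) := by
  refine .of_hasDerivAt hI hA
    (G := fun x => c₁ * deriv F₁ x + c₂ * deriv F₂ x)
    (H := fun x => c₁ * deriv (deriv F₁) x + c₂ * deriv (deriv F₂) x)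
    (fun x hx => ?_) (fun x hx => ?_) fun x hx => ?_
  · exact ((h₁.1.hasDerivAt_deriv hI hx).1.const_mul c₁).add
      ((h₂.1.hasDerivAt_deriv hI hx).1.const_mul c₂)
  · exact ((h₁.1.hasDerivAt_deriv hI hx).2.const_mul c₁).add
      ((h₂.1.hasDerivAt_deriv hI hx).2.const_mul c₂)
  · linear_combination c₁ * h₁.2 x hx + c₂ * h₂.2 x hx

/-- The Wronskian of two solutions solves `A V' + B V = 0`. -/
theorem IsSolutionOn.hasDerivAt_wronskian {I : Set ℝ} {A B : Polynomial ℝ} {m : ℝ}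
    {F₁ F₂ : ℝ → ℝ} (hI : IsOpen I) (hA : ∀ x ∈ I, 0 < A.eval x) (h₁ : IsSolutionOn I A B m F₁)
    (h₂ : IsSolutionOn I A B m F₂) {x : ℝ} (hx : x ∈ I) :
    HasDerivAt (fun x => F₁ x * deriv F₂ x - F₂ x * deriv F₁ x)
      (-(B.eval x / A.eval x) * (F₁ x * deriv F₂ x - F₂ x * deriv F₁ x)) x := by
  obtain ⟨a1, a2⟩ := h₁.1.hasDerivAt_deriv hI hx
  obtain ⟨b1, b2⟩ := h₂.1.hasDerivAt_deriv hI hx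
  have e1 := h₁.2 x hx
  have e2 := h₂.2 x hx
  have hA' := (hA x hx).ne'
  refine ((a1.mul b2).sub (b1.mul a2)).congr_deriv ?_
  field_simp
  linear_combination F₁ x * e2 - F₂ x * e1

/-- Abel's identity. -/
theorem IsSolutionOn.exists_wronskian_eq {I : Set ℝ} {A B : Polynomial ℝ} {m : ℝ}
    {F₁ F₂ W : ℝ → ℝ} (hI : IsOpen I) (hIc : IsPreconnected I) (hA : ∀ x ∈ I, 0 < A.eval x)
    (hW : IsWronskianOn I A B W)
    (h₁ : IsSolutionOn I A B m F₁) (h₂ : IsSolutionOn I A B m F₂) :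
    ∃ k : ℝ, ∀ x ∈ I, F₁ x * deriv F₂ x - F₂ x * deriv F₁ x = k * W x := by
  have hd : ∀ x ∈ I, HasDerivAt (fun x => (F₁ x * deriv F₂ x - F₂ x * deriv F₁ x) / W x) 0 x := by
    intro x hx
    obtain ⟨hW0, hW1⟩ := hW x hx
    refine ((h₁.hasDerivAt_wronskian hI hA h₂ hx).div hW1 hW0.ne').congr_deriv ?_
    ring
  obtain ⟨k, hk⟩ := hI.exists_is_const_of_deriv_eq_zero hIc
    (fun x hx => (hd x hx).differentiableAt.differentiableWithinAt) fun x hx => (hd x hx).deriv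
  exact ⟨k, fun x hx => by rw [← hk x hx, div_mul_cancel₀ _ (hW x hx).1.ne']⟩

/-- The gauge transformation `u = θ F` with `θ' / θ = (B₁ - B₀) / (2 A)` turns the equation
`A F'' + B₁ F' - m₁ F = 0` into `A u'' + B₀ u' - m₀ u = 0` up to the difference of the Liouville
invariants. The zeroth-order coefficients enter through their values at a point only, so that the
identity applies to variable coefficients as well. -/
theorem exists_hasDerivAt_gauge {I : Set ℝ} {A B₀ B₁ : Polynomial ℝ}
    (hA : ∀ x ∈ I, 0 < A.eval x) {θ F G H : ℝ → ℝ}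
    (hθ : ∀ x ∈ I, HasDerivAt θ (θ x * ((B₁.eval x - B₀.eval x) / (2 * A.eval x))) x)
    (h1 : ∀ x ∈ I, HasDerivAt F (G x) x) (h2 : ∀ x ∈ I, HasDerivAt G (H x) x) :
    ∃ u' u'' : ℝ → ℝ, (∀ x ∈ I, HasDerivAt (fun x => θ x * F x) (u' x) x) ∧
      (∀ x ∈ I, HasDerivAt u' (u'' x) x) ∧
      ∀ x ∈ I, ∀ m₀ m₁ : ℝ,
        A.eval x * (A.eval x * u'' x + B₀.eval x * u' x - m₀ * (θ x * F x)) =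
          θ x * (A.eval x * (A.eval x * H x + B₁.eval x * G x - m₁ * F x)
            + F x * ((liouvilleInvariant A B₀ m₀).eval x
              - (liouvilleInvariant A B₁ m₁).eval x)) := by
  have hη : ∀ x ∈ I, HasDerivAt (fun x => (B₁.eval x - B₀.eval x) / (2 * A.eval x))
      (((B₁.derivative.eval x - B₀.derivative.eval x) * (2 * A.eval x)
        - (B₁.eval x - B₀.eval x) * (2 * A.derivative.eval x)) / (2 * A.eval x) ^ 2) x :=
    fun x hx => ((B₁.hasDerivAt x).sub (B₀.hasDerivAt x)).div ((A.hasDerivAt x).const_mul 2)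
      (mul_ne_zero two_ne_zero (hA x hx).ne')
  set η : ℝ → ℝ := fun x => (B₁.eval x - B₀.eval x) / (2 * A.eval x) with hηdef
  refine ⟨fun x => θ x * (η x * F x + G x), _, fun x hx => ?_, fun x hx =>
    (hθ x hx).mul (((hη x hx).mul (h1 x hx)).add (h2 x hx)), fun x hx m₀ m₁ => ?_⟩
  · exact ((hθ x hx).mul (h1 x hx)).congr_deriv (by simp only [hηdef]; ring)
  · have := (hA x hx).ne'
    rw [liouvilleInvariant_eval, liouvilleInvariant_eval]
    simp only [hηdef]
    field_simp
    ring

/-- The change of variables `y` with `y' = k W / F₀²` followed by the gauge transformation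
`u = F₀ · (f ∘ y)` turns the operator `f ↦ f''` into `u ↦ A u'' + B u' - m u`, up to the factor
`A (y')² F₀`. -/
theorem exists_hasDerivAt_pullback {I D : Set ℝ} {A B : Polynomial ℝ} {m k : ℝ}
    {W F₀ y f f' f'' : ℝ → ℝ} (hI : IsOpen I) (hA : ∀ x ∈ I, 0 < A.eval x)
    (hW : IsWronskianOn I A B W) (hF₀ : IsSolutionOn I A B m F₀) (hne : ∀ x ∈ I, F₀ x ≠ 0)
    (hyD : MapsTo y I D) (hy : ∀ x ∈ I, HasDerivAt y (k * W x / F₀ x ^ 2) x)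
    (h1 : ∀ x ∈ D, HasDerivAt f (f' x) x) (h2 : ∀ x ∈ D, HasDerivAt f' (f'' x) x) :
    ∃ u' u'' : ℝ → ℝ, (∀ x ∈ I, HasDerivAt (fun x => F₀ x * f (y x)) (u' x) x) ∧
      (∀ x ∈ I, HasDerivAt u' (u'' x) x) ∧
      ∀ x ∈ I, A.eval x * u'' x + B.eval x * u' x - m * (F₀ x * f (y x)) =
        A.eval x * F₀ x * (k * W x / F₀ x ^ 2) ^ 2 * f'' (y x) := by
  have hfy : ∀ x ∈ I, HasDerivAt (fun x => f (y x)) (f' (y x) * (k * W x / F₀ x ^ 2)) x :=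
    fun x hx => (h1 _ (hyD hx)).comp x (hy x hx)
  have hfy' : ∀ x ∈ I, HasDerivAt (fun x => f' (y x)) (f'' (y x) * (k * W x / F₀ x ^ 2)) x :=
    fun x hx => (h2 _ (hyD hx)).comp x (hy x hx)
  refine ⟨fun x => deriv F₀ x * f (y x) + k * W x / F₀ x * f' (y x), _, fun x hx => ?_,
    fun x hx => (((hF₀.1.hasDerivAt_deriv hI hx).2.mul (hfy x hx)).add
      ((((hW x hx).2.const_mul k).div (hF₀.1.hasDerivAt_deriv hI hx).1 (hne x hx)).mul
        (hfy' x hx))), fun x hx => ?_⟩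
  · refine ((hF₀.1.hasDerivAt_deriv hI hx).1.mul (hfy x hx)).congr_deriv ?_
    have := hne x hx
    field_simp
  · have e := hF₀.2 x hx
    have := hne x hx
    have := (hA x hx).ne'
    simp only [Pi.div_apply]
    field_simp
    linear_combination F₀ x ^ 3 * f (y x) * e

/-! ### Necessity of the volatility form -/

theorem IsChangeOfVariables.hasDerivAt {y : ℝ → ℝ} {I J : Set ℝ} (hI : IsOpen I)
    (hy : IsChangeOfVariables y I J) {x : ℝ} (hx : x ∈ I) : HasDerivAt y (deriv y x) x :=
  ((hy.2.1.differentiableOn (by simp)).differentiableAt (hI.mem_nhds hx)).hasDerivAt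

theorem IsChangeOfVariables.congr {y y' : ℝ → ℝ} {I J : Set ℝ} (hI : IsOpen I)
    (hy : IsChangeOfVariables y I J) (h : EqOn y' y I) : IsChangeOfVariables y' I J := by
  refine ⟨hy.1.congr h.symm, hy.2.1.congr h, fun z hz => ?_⟩
  rw [(h.eventuallyEq_of_mem (hI.mem_nhds hz)).deriv_eq]
  exact hy.2.2 z hz

namespace DriftlessDiffusion

theorem isEigenfunction_of_hasDerivAt (Y : DriftlessDiffusion) {lam : ℝ} {f g k : ℝ → ℝ}
    (h1 : ∀ x ∈ Y.D, HasDerivAt f (g x) x) (h2 : ∀ x ∈ Y.D, HasDerivAt g (k x) x)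
    (hk : ContinuousOn k Y.D) (h : ∀ x ∈ Y.D, 1 / 2 * Y.σ x ^ 2 * k x = lam * f x) :
    Y.IsEigenfunction lam f := by
  refine ⟨contDiffOn_two_of_hasDerivAt Y.isOpen_D h1 h2 hk, fun x hx => ?_⟩
  rw [generator, deriv_deriv_eq_of_hasDerivAt Y.isOpen_D h1 h2 hx]
  exact h x hx

theorem isEigenfunction_zero_affine (Y : DriftlessDiffusion) (u v : ℝ) :
    Y.IsEigenfunction 0 (fun y => u + v * y) := by
  refine Y.isEigenfunction_of_hasDerivAt (g := fun _ => v) (k := fun _ => 0) (fun x _ => ?_)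
    (fun x _ => hasDerivAt_const x v) continuousOn_const (fun x _ => by ring)
  simpa using ((hasDerivAt_id x).const_mul v).const_add u

/-- The equation `ℒ f = f` has a positive solution `f` on `D`, and reduction of order yields a
second solution `f r` with `r' = 1 / f²`. -/
theorem exists_pos_eigenfunction_one (Y : DriftlessDiffusion) :
    ∃ f f' r : ℝ → ℝ, (∀ x ∈ Y.D, 0 < f x) ∧ (∀ x ∈ Y.D, HasDerivAt f (f' x) x) ∧
      (∀ x ∈ Y.D, HasDerivAt f' (2 / Y.σ x ^ 2 * f x) x) ∧
      (∀ x ∈ Y.D, HasDerivAt r (1 / f x ^ 2) x) ∧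
      Y.IsEigenfunction 1 f ∧ Y.IsEigenfunction 1 (fun x => f x * r x) := by
  have hσ : ∀ x ∈ Y.D, Y.σ x ^ 2 ≠ 0 := fun x hx => pow_ne_zero 2 (Y.σ_pos x hx).ne'
  have hq : ContinuousOn (fun x => 2 / Y.σ x ^ 2) Y.D :=
    continuousOn_const.div (Y.smooth_σ.continuousOn.pow 2) hσ
  obtain ⟨f, f', hpos, h1, h2⟩ := exists_pos_solution_deriv_two_eq_mul Y.isOpen_D
    Y.ordConnected_D Y.nonempty_D hq fun x _ => by positivity
  have cf : ContinuousOn f Y.D := fun x hx => (h1 x hx).continuousAt.continuousWithinAt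
  obtain ⟨x₀, hx₀⟩ := Y.nonempty_D
  have cr : ContinuousOn (fun x => 1 / f x ^ 2) Y.D :=
    continuousOn_const.div (cf.pow 2) fun x hx => pow_ne_zero 2 (hpos x hx).ne'
  have hr : ∀ x ∈ Y.D, HasDerivAt (fun x => ∫ s in x₀..x, 1 / f s ^ 2) (1 / f x ^ 2) x :=
    fun x hx => hasDerivAt_integral_of_continuousOn Y.isOpen_D Y.ordConnected_D cr hx₀ hx
  set r : ℝ → ℝ := fun x => ∫ s in x₀..x, 1 / f s ^ 2
  have cr' : ContinuousOn r Y.D := fun x hx => (hr x hx).continuousAt.continuousWithinAt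
  refine ⟨f, f', r, hpos, h1, h2, hr, ?_, ?_⟩
  · refine Y.isEigenfunction_of_hasDerivAt h1 h2 (hq.mul cf) fun x hx => ?_
    have := (Y.σ_pos x hx).ne'
    field_simp
  · refine Y.isEigenfunction_of_hasDerivAt (g := fun x => f' x * r x + 1 / f x)
      (k := fun x => 2 / Y.σ x ^ 2 * f x * r x) (fun x hx => ?_) (fun x hx => ?_)
      ((hq.mul cf).mul cr') fun x hx => ?_
    · refine ((h1 x hx).mul (hr x hx)).congr_deriv ?_
      have := (hpos x hx).ne'
      field_simp
    · have hf := (hpos x hx).ne'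
      refine (((h2 x hx).mul (hr x hx)).add
        ((hasDerivAt_const x (1 : ℝ)).div (h1 x hx) hf)).congr_deriv ?_
      field_simp
      ring
    · have := (Y.σ_pos x hx).ne'
      field_simp

/-- If after a change of variables and gauge transformations all eigenfunctions for the eigenvalues
`0` and `1` become solutions of equations with the same leading coefficient `A`, then the volatility
function has the asserted form, with `R` the difference of the two Liouville invariants. -/
theorem exists_hasVolatilityForm_of_gauge (Y : DriftlessDiffusion) {I : Set ℝ} (hI : IsOpen I)
    (hIc : IsPreconnected I) {A B₀ B₁ : Polynomial ℝ} {m₀ m₁ : ℝ} {W y h₀ h₁ : ℝ → ℝ}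
    (hdA : A.natDegree ≤ 2) (hdB₀ : B₀.natDegree ≤ 1) (hdB₁ : B₁.natDegree ≤ 1)
    (hA : ∀ x ∈ I, 0 < A.eval x) (hW : IsWronskianOn I A B₀ W)
    (hy : IsChangeOfVariables y I Y.D)
    (H₀ : ∀ f, Y.IsEigenfunction 0 f →
      ∃ F, IsSolutionOn I A B₀ m₀ F ∧ ∀ x ∈ I, f (y x) = h₀ x * F x)
    (H₁ : ∀ f, Y.IsEigenfunction 1 f →
      ∃ F, IsSolutionOn I A B₁ m₁ F ∧ ∀ x ∈ I, f (y x) = h₁ x * F x) :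
    ∃ F₁ F₂ : ℝ → ℝ, IsSolutionOn I A B₀ m₀ F₁ ∧ IsSolutionOn I A B₀ m₀ F₂ ∧
      LinIndepOn I F₁ F₂ ∧ Y.HasVolatilityForm I (fun x => A.eval x) W F₁ F₂ := by
  have hyD : MapsTo y I Y.D := hy.1.mapsTo
  obtain ⟨x₀, hx₀⟩ : I.Nonempty := by
    obtain ⟨d, hd⟩ := Y.nonempty_D
    obtain ⟨x, hx, -⟩ := hy.1.surjOn hd
    exact ⟨x, hx⟩
  -- The eigenfunctions `1` and `y` for the eigenvalue `0` determine `h₀` and `y`.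
  obtain ⟨F₀, hF₀, e₀⟩ := H₀ _ (Y.isEigenfunction_zero_affine 1 0)
  obtain ⟨E, hE, eE⟩ := H₀ _ (Y.isEigenfunction_zero_affine 0 1)
  simp only [zero_mul, add_zero, zero_add, one_mul] at e₀ eE
  have hne : ∀ x ∈ I, F₀ x ≠ 0 := fun x hx h => by simpa [h] using e₀ x hx
  have hyE : ∀ x ∈ I, y x = E x / F₀ x := fun x hx => by
    rw [eq_div_iff (hne x hx), eE x hx]
    linear_combination -E x * e₀ x hx
  obtain ⟨k, hk⟩ := IsSolutionOn.exists_wronskian_eq hI hIc hA hW hF₀ hE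
  have hdy : ∀ x ∈ I, HasDerivAt y (k * W x / F₀ x ^ 2) x := by
    intro x hx
    have h := (hE.1.hasDerivAt_deriv hI hx).1.div (hF₀.1.hasDerivAt_deriv hI hx).1 (hne x hx)
    refine (h.congr_of_eventuallyEq ?_).congr_deriv ?_
    · filter_upwards [hI.mem_nhds hx] with t ht using hyE t ht
    · rw [← hk x hx]; ring
  have hk0 : k ≠ 0 := by
    rintro rfl
    have := (hdy x₀ hx₀).deriv
    exact hy.2.2 x₀ hx₀ (by simpa using this)
  obtain ⟨f, f', r, hpos, d1, d2, dr, ef, efr⟩ := Y.exists_pos_eigenfunction_one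
  obtain ⟨F, hF, eF⟩ := H₁ _ ef
  obtain ⟨G, hG, eG⟩ := H₁ _ efr
  have hFne : ∀ x ∈ I, F x ≠ 0 := fun x hx h => by
    have h1 := eF x hx
    rw [h, mul_zero] at h1
    exact (hpos _ (hyD hx)).ne' h1
  have hh₁ : ∀ x ∈ I, h₁ x ≠ 0 := fun x hx h => by
    have h1 := eF x hx
    rw [h, zero_mul] at h1
    exact (hpos _ (hyD hx)).ne' h1
  -- `θ = F₀ h₁` is differentiable because `f ∘ y` and `F` are.
  set θ : ℝ → ℝ := fun x => F₀ x * f (y x) / F x with hθdef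
  have hθne : ∀ x ∈ I, θ x ≠ 0 := fun x hx =>
    div_ne_zero (mul_ne_zero (hne x hx) (hpos _ (hyD hx)).ne') (hFne x hx)
  obtain ⟨u', u'', du', du'', hu⟩ :=
    exists_hasDerivAt_pullback hI hA hW hF₀ hne hyD hdy d1 d2
  obtain ⟨θ', hθd⟩ : ∃ θ' : ℝ → ℝ, ∀ x ∈ I, HasDerivAt θ (θ' x) x := ⟨_, fun x hx =>
    (du' x hx).div (hF.1.hasDerivAt_deriv hI hx).1 (hFne x hx)⟩
  -- Comparing Wronskians shows that `θ² V = k W` with `V` the Wronskian of `F` and `G`.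
  have hGF : EqOn (fun x => r (y x)) (fun x => G x / F x) I := fun x hx => by
    have h1 := eF x hx
    have h2 := eG x hx
    simp only at h2 ⊢
    rw [eq_div_iff (hFne x hx)]
    apply mul_left_cancel₀ (hh₁ x hx)
    rw [← h2, h1]
    ring
  have hV : EqOn (fun x => θ x ^ 2 * (F x * deriv G x - G x * deriv F x))
      (fun x => k * W x) I := fun x hx => by
    have h1 := eqOn_of_hasDerivAt_of_eqOn hI hGF
      (fun x hx => (dr _ (hyD hx)).comp x (hdy x hx))
      (fun x hx => (hG.1.hasDerivAt_deriv hI hx).1.div (hF.1.hasDerivAt_deriv hI hx).1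
        (hFne x hx)) hx
    have hf := (hpos _ (hyD hx)).ne'
    have := hFne x hx
    have := hne x hx
    simp only [hθdef] at h1 ⊢
    field_simp at h1 ⊢
    linear_combination -h1
  have hVne : ∀ x ∈ I, F x * deriv G x - G x * deriv F x ≠ 0 := fun x hx h => by
    have h1 := hV hx
    simp only [h, mul_zero] at h1
    exact mul_ne_zero hk0 (hW x hx).1.ne' h1.symm
  have hθ : ∀ x ∈ I,
      HasDerivAt θ (θ x * ((B₁.eval x - B₀.eval x) / (2 * A.eval x))) x := by
    intro x hx
    refine (hθd x hx).congr_deriv ?_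
    have h1 := eqOn_of_hasDerivAt_of_eqOn hI hV
      (fun x hx => ((hθd x hx).pow 2).mul (hF.hasDerivAt_wronskian hI hA hG hx))
      (fun x hx => (hW x hx).2.const_mul k) hx
    have h2 := hV hx
    have hA' := (hA x hx).ne'
    simp only at h1 h2
    norm_num at h1
    apply mul_left_cancel₀ (mul_ne_zero (hθne x hx) (hVne x hx))
    linear_combination 1 / 2 * h1 + B₀.eval x / (2 * A.eval x) * h2
  -- Comparing the two equations for `u = F₀ · (f ∘ y) = θ F`.
  have hR : ∀ x ∈ I, A.eval x ^ 2 * (k * W x / F₀ x ^ 2) ^ 2 * (2 / Y.σ (y x) ^ 2) =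
      (liouvilleInvariant A B₀ m₀ - liouvilleInvariant A B₁ m₁).eval x := by
    intro x hx
    obtain ⟨v', v'', dv', dv'', hv⟩ := exists_hasDerivAt_gauge hA hθ
      (fun x hx => (hF.1.hasDerivAt_deriv hI hx).1) (fun x hx => (hF.1.hasDerivAt_deriv hI hx).2)
    have huv : EqOn (fun x => F₀ x * f (y x)) (fun x => θ x * F x) I := fun x hx => by
      simp only [hθdef]
      rw [div_mul_cancel₀ _ (hFne x hx)]
    have huv' := eqOn_of_hasDerivAt_of_eqOn hI huv du' dv'
    have huv'' := eqOn_of_hasDerivAt_of_eqOn hI huv' du'' dv''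
    have e1 := hu x hx
    have e2 := hv x hx m₀ m₁
    have e3 : F₀ x * f (y x) = θ x * F x := huv hx
    rw [← huv' hx, ← huv'' hx, ← e3, hF.2 x hx, e1, mul_zero, zero_add] at e2
    rw [Polynomial.eval_sub]
    apply mul_left_cancel₀ (mul_ne_zero (hne x hx) (hpos _ (hyD hx)).ne')
    linear_combination e2 - ((liouvilleInvariant A B₀ m₀).eval x
      - (liouvilleInvariant A B₁ m₁).eval x) * e3
  have hRpos : ∀ x ∈ I,
      0 < (liouvilleInvariant A B₀ m₀ - liouvilleInvariant A B₁ m₁).eval x := by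
    intro x hx
    rw [← hR x hx]
    have := hA x hx
    have := Y.σ_pos _ (hyD hx)
    have := (hW x hx).1
    have := hne x hx
    positivity
  refine ⟨F₀, E, hF₀, hE, ?_, liouvilleInvariant A B₀ m₀ - liouvilleInvariant A B₁ m₁,
    √2 * |k|, 1, 0, 0, 1, ?_, fun x hx => (hRpos x hx).ne', by norm_num, ?_, ?_, ?_⟩
  · intro u v huv
    have hz : EqOn (fun x => u + v * y x) (fun _ => 0) I := fun x hx => by
      simp only
      rw [hyE x hx]
      have := hne x hx
      field_simp
      linear_combination huv x hx
    have hv := eqOn_of_hasDerivAt_of_eqOn hI hz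
      (fun x hx => ((hdy x hx).const_mul v).const_add u) (fun x _ => hasDerivAt_const x 0) hx₀
    have hv0 : v = 0 := by
      refine (mul_eq_zero.1 hv).resolve_right ?_
      rw [← (hdy x₀ hx₀).deriv]
      exact hy.2.2 x₀ hx₀
    subst hv0
    exact ⟨by simpa using hz hx₀, rfl⟩
  · exact (Polynomial.natDegree_sub_le _ _).trans (max_le
      (natDegree_liouvilleInvariant_le hdA hdB₀ _) (natDegree_liouvilleInvariant_le hdA hdB₁ _))
  · intro x hx
    simpa using hne x hx
  · refine hy.congr hI fun x hx => ?_
    simp [hyE x hx]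
  · intro x hx
    have h1 := hR x hx
    have hσ := Y.σ_pos _ (hyD hx)
    have hA' := hA x hx
    have hR' := hRpos x hx
    have hW' := (hW x hx).1
    have hne' := hne x hx
    rw [show (0 * F₀ x + 1 * E x) / (1 * F₀ x + 0 * E x) = y x by simp [hyE x hx]]
    rw [show (1 * F₀ x + 0 * E x) = F₀ x by ring]
    generalize (liouvilleInvariant A B₀ m₀ - liouvilleInvariant A B₁ m₁).eval x = P at h1 hR' ⊢
    refine (pow_left_inj₀ hσ.le (by positivity) two_ne_zero).1 ?_
    simp only [mul_pow, div_pow]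
    rw [Real.sq_sqrt hA'.le, Real.sq_sqrt (div_pos hA' hR').le, Real.sq_sqrt zero_le_two, sq_abs]
    field_simp at h1 ⊢
    linear_combination -h1

end DriftlessDiffusion

/-! ### The reduction of the eigenfunction equations for a given volatility -/

theorem IsWronskianOn.hasDerivAt_sqrt_div {I : Set ℝ} {A B₀ B₁ : Polynomial ℝ} {W₀ W₁ : ℝ → ℝ}
    (h₀ : IsWronskianOn I A B₀ W₀) (h₁ : IsWronskianOn I A B₁ W₁) {x : ℝ} (hx : x ∈ I) :
    HasDerivAt (fun x => √(W₁ x / W₀ x))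
      (√(W₁ x / W₀ x) * ((B₀.eval x - B₁.eval x) / (2 * A.eval x))) x := by
  obtain ⟨p0, d0⟩ := h₀ x hx
  obtain ⟨p1, d1⟩ := h₁ x hx
  have hpos : 0 < W₁ x / W₀ x := div_pos p1 p0
  refine ((d1.div d0 p0.ne').sqrt hpos.ne').congr_deriv ?_
  have hs := Real.sqrt_pos.2 hpos
  have hs2 := Real.sq_sqrt hpos.le
  rw [div_eq_iff (by simpa using hs.ne')]
  simp only [Pi.div_apply]
  have h3 : √(W₁ x / W₀ x) * ((B₀.eval x - B₁.eval x) / (2 * A.eval x)) * (2 * √(W₁ x / W₀ x))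
      = √(W₁ x / W₀ x) ^ 2 * ((B₀.eval x - B₁.eval x) / A.eval x) := by ring
  rw [h3, hs2]
  field_simp
  ring

namespace DriftlessDiffusion

/-- If the volatility function has the asserted form, then the change of variables
`y = (c₃ F₁ + c₄ F₂) / (c₁ F₁ + c₂ F₂)` reduces `ℒ f = lam f` to every equation
`A F'' + B₁ F' - m₁ F = 0` whose Liouville invariant is that of the original equation minus
`lam κ R`, for a constant `κ > 0`. -/
theorem exists_gauge_of_volatility (Y : DriftlessDiffusion) {I : Set ℝ} (hI : IsOpen I)
    (hIc : IsPreconnected I) {A B₀ R : Polynomial ℝ} {m₀ C c₁ c₂ c₃ c₄ : ℝ} {W F₁ F₂ : ℝ → ℝ}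
    (hA : ∀ x ∈ I, 0 < A.eval x) (hW : IsWronskianOn I A B₀ W)
    (hF₁ : IsSolutionOn I A B₀ m₀ F₁) (hF₂ : IsSolutionOn I A B₀ m₀ F₂)
    (hden : ∀ x ∈ I, c₁ * F₁ x + c₂ * F₂ x ≠ 0)
    (hy : IsChangeOfVariables
      (fun x => (c₃ * F₁ x + c₄ * F₂ x) / (c₁ * F₁ x + c₂ * F₂ x)) I Y.D)
    (hσ : ∀ x ∈ I, Y.σ ((c₃ * F₁ x + c₄ * F₂ x) / (c₁ * F₁ x + c₂ * F₂ x)) =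
      C * √(A.eval x) * (W x / (c₁ * F₁ x + c₂ * F₂ x) ^ 2) * √(A.eval x / R.eval x)) :
    (∀ x ∈ I, 0 < R.eval x) ∧ ∃ κ > 0, ∀ (lam : ℝ) (B₁ : Polynomial ℝ) (m₁ : ℝ) (W₁ : ℝ → ℝ),
      IsWronskianOn I A B₁ W₁ →
      liouvilleInvariant A B₁ m₁ = liouvilleInvariant A B₀ m₀ - Polynomial.C (lam * κ) * R →
      ∃ h : ℝ → ℝ, (∀ x ∈ I, h x ≠ 0) ∧ ∀ f, Y.IsEigenfunction lam f →
        ∃ F, IsSolutionOn I A B₁ m₁ F ∧ ∀ x ∈ I,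
          f ((c₃ * F₁ x + c₄ * F₂ x) / (c₁ * F₁ x + c₂ * F₂ x)) = h x * F x := by
  have hF₀ := hF₁.linear_combination hI hA hF₂ c₁ c₂
  have hN := hF₁.linear_combination hI hA hF₂ c₃ c₄
  set F₀ : ℝ → ℝ := fun x => c₁ * F₁ x + c₂ * F₂ x with hF₀def
  set N : ℝ → ℝ := fun x => c₃ * F₁ x + c₄ * F₂ x with hNdef
  set y : ℝ → ℝ := fun x => N x / F₀ x with hydef
  change ∀ x ∈ I, F₀ x ≠ 0 at hden
  change ∀ x ∈ I, Y.σ (y x) = C * √(A.eval x) * (W x / F₀ x ^ 2) * √(A.eval x / R.eval x) at hσ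
  change _ ∧ ∃ κ > 0, ∀ (lam : ℝ) (B₁ : Polynomial ℝ) (m₁ : ℝ) (W₁ : ℝ → ℝ),
      IsWronskianOn I A B₁ W₁ →
      liouvilleInvariant A B₁ m₁ = liouvilleInvariant A B₀ m₀ - Polynomial.C (lam * κ) * R →
      ∃ h : ℝ → ℝ, (∀ x ∈ I, h x ≠ 0) ∧ ∀ f, Y.IsEigenfunction lam f →
        ∃ F, IsSolutionOn I A B₁ m₁ F ∧ ∀ x ∈ I, f (y x) = h x * F x
  have hyD : MapsTo y I Y.D := hy.1.mapsTo
  obtain ⟨x₀, hx₀⟩ : I.Nonempty := by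
    obtain ⟨d, hd⟩ := Y.nonempty_D
    obtain ⟨x, hx, -⟩ := hy.1.surjOn hd
    exact ⟨x, hx⟩
  obtain ⟨k, hk⟩ := IsSolutionOn.exists_wronskian_eq hI hIc hA hW hF₀ hN
  have hdy : ∀ x ∈ I, HasDerivAt y (k * W x / F₀ x ^ 2) x := by
    intro x hx
    refine ((hN.1.hasDerivAt_deriv hI hx).1.div
      (hF₀.1.hasDerivAt_deriv hI hx).1 (hden x hx)).congr_deriv ?_
    rw [← hk x hx]; ring
  have hk0 : k ≠ 0 := by
    rintro rfl
    have := (hdy x₀ hx₀).deriv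
    exact hy.2.2 x₀ hx₀ (by simpa using this)
  have hC : C ≠ 0 := by
    rintro rfl
    have h1 := Y.σ_pos _ (hyD hx₀)
    rw [hσ x₀ hx₀] at h1
    simp at h1
  -- A negative value of `R` would make the last square root, hence the volatility, vanish.
  have hR : ∀ x ∈ I, 0 < R.eval x := by
    intro x hx
    by_contra hneg
    have h1 := Y.σ_pos _ (hyD hx)
    rw [hσ x hx, Real.sqrt_eq_zero_of_nonpos
      (div_nonpos_of_nonneg_of_nonpos (hA x hx).le (not_lt.1 hneg)), mul_zero] at h1
    exact lt_irrefl _ h1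
  refine ⟨hR, 2 * k ^ 2 / C ^ 2, by positivity, fun lam B₁ m₁ W₁ hW₁ hT => ?_⟩
  have hφ : ∀ x ∈ I, 0 < √(W₁ x / W x) := fun x hx =>
    Real.sqrt_pos.2 (div_pos (hW₁ x hx).1 (hW x hx).1)
  refine ⟨fun x => (√(W₁ x / W x) * F₀ x)⁻¹, fun x hx =>
    inv_ne_zero (mul_ne_zero (hφ x hx).ne' (hden x hx)), fun f hf => ?_⟩
  obtain ⟨u', u'', du', du'', hu⟩ := exists_hasDerivAt_pullback hI hA hW hF₀ hden hyD hdy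
    (fun x hx => (hf.1.hasDerivAt_deriv Y.isOpen_D hx).1)
    (fun x hx => (hf.1.hasDerivAt_deriv Y.isOpen_D hx).2)
  obtain ⟨v', v'', dv', dv'', hv⟩ := exists_hasDerivAt_gauge (B₀ := B₁) (B₁ := B₀) hA
    (fun x hx => hW.hasDerivAt_sqrt_div hW₁ hx) du' du''
  refine ⟨fun x => √(W₁ x / W x) * (F₀ x * f (y x)),
    .of_hasDerivAt hI hA dv' dv'' fun x hx => ?_, fun x hx => ?_⟩
  · have e1 := hv x hx m₁ m₀
    have e2 := hf.2 _ (hyD hx)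
    have hA' := hA x hx
    have hR' := hR x hx
    have hW' := (hW x hx).1.ne'
    have hd' := hden x hx
    have e3 : Y.σ (y x) ^ 2 = C ^ 2 * A.eval x ^ 2 * W x ^ 2 / (F₀ x ^ 4 * R.eval x) := by
      rw [hσ x hx]
      simp only [mul_pow, div_pow]
      rw [Real.sq_sqrt hA'.le, Real.sq_sqrt (div_pos hA' hR').le]
      field_simp
    have e4 : A.eval x ^ 2 * (k * W x / F₀ x ^ 2) ^ 2 * deriv (deriv f) (y x)
        = lam * (2 * k ^ 2 / C ^ 2) * R.eval x * f (y x) := by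
      rw [generator, e3] at e2
      field_simp at e2 ⊢
      linear_combination e2
    rw [hu x hx, hT, Polynomial.eval_sub, Polynomial.eval_mul, Polynomial.eval_C] at e1
    refine (mul_eq_zero.1 (e1.trans ?_)).resolve_left hA'.ne'
    linear_combination √(W₁ x / W x) * F₀ x * e4
  · have := (hφ x hx).ne'
    have := hden x hx
    field_simp

end DriftlessDiffusion

/-! ### The Kummer and the hypergeometric equation -/

open Polynomial in
/-- The first-order coefficient `b - w x` of the scaled Kummer equation, and with `b = γ`,
`w = 1 + α + β` that of the hypergeometric equation. -/
noncomputable def linearCoefficient (b w : ℝ) : Polynomial ℝ := C b - C w * X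

theorem linearCoefficient_eval (b w x : ℝ) : (linearCoefficient b w).eval x = b - w * x := by
  simp [linearCoefficient]

theorem natDegree_linearCoefficient_le (b w : ℝ) : (linearCoefficient b w).natDegree ≤ 1 := by
  rw [linearCoefficient]
  compute_degree

theorem derivative_linearCoefficient (b w : ℝ) :
    (linearCoefficient b w).derivative = Polynomial.C (-w) := by
  simp [linearCoefficient]

open Polynomial in
/-- The leading coefficient `x (1 - x)` of the hypergeometric equation. -/
noncomputable def hypergeometricLeading : Polynomial ℝ := X * (1 - X)

theorem hypergeometricLeading_eval (x : ℝ) : hypergeometricLeading.eval x = x * (1 - x) := by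
  simp [hypergeometricLeading]

theorem natDegree_hypergeometricLeading_le : hypergeometricLeading.natDegree ≤ 2 := by
  rw [hypergeometricLeading]
  compute_degree

theorem hypergeometricLeading_eval_pos : ∀ x ∈ Ioo (0 : ℝ) 1, 0 < hypergeometricLeading.eval x :=
  fun x hx => by
    rw [hypergeometricLeading_eval]
    exact mul_pos hx.1 (sub_pos.2 hx.2)

theorem isScaledKummerSolution_iff {a b w : ℝ} {F : ℝ → ℝ} : IsScaledKummerSolution a b w F ↔
    IsSolutionOn (Ioi 0) Polynomial.X (linearCoefficient b w) (a * w) F := by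
  simp only [IsScaledKummerSolution, IsSolutionOn, Polynomial.eval_X, linearCoefficient_eval]

theorem isHypergeometricSolution_iff {α β : ℂ} {γ : ℝ} {F : ℝ → ℝ} :
    IsHypergeometricSolution α β γ F ↔ IsSolutionOn (Ioo 0 1) hypergeometricLeading
      (linearCoefficient γ (1 + (α + β).re)) (α * β).re F := by
  simp only [IsHypergeometricSolution, IsSolutionOn, hypergeometricLeading_eval,
    linearCoefficient_eval]

theorem isWronskianOn_kummerWronskian (b w : ℝ) :
    IsWronskianOn (Ioi 0) Polynomial.X (linearCoefficient b w) (kummerWronskian b w) := by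
  intro x (hx : 0 < x)
  refine ⟨mul_pos (Real.rpow_pos_of_pos hx _) (Real.exp_pos _), ?_⟩
  have h1 := Real.hasDerivAt_rpow_const (p := -b) (Or.inl hx.ne')
  have h2 : HasDerivAt (fun x => Real.exp (w * x)) (Real.exp (w * x) * w) x := by
    simpa using ((hasDerivAt_id x).const_mul w).exp
  refine (h1.mul h2).congr_deriv ?_
  rw [Real.rpow_sub_one hx.ne', linearCoefficient_eval, Polynomial.eval_X, kummerWronskian]
  field_simp
  ring

theorem isWronskianOn_hypergeometricWronskian (α β : ℂ) (γ : ℝ) :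
    IsWronskianOn (Ioo 0 1) hypergeometricLeading (linearCoefficient γ (1 + (α + β).re))
      (hypergeometricWronskian α β γ) := by
  intro x hx
  have hx0 : 0 < x := hx.1
  have hx1 : 0 < 1 - x := sub_pos.2 hx.2
  refine ⟨mul_pos (Real.rpow_pos_of_pos hx0 _) (Real.rpow_pos_of_pos hx1 _), ?_⟩
  have h1 := Real.hasDerivAt_rpow_const (p := -γ) (Or.inl hx0.ne')
  have h2 := ((hasDerivAt_id x).const_sub 1).rpow_const (p := γ - (α + β).re - 1)
    (Or.inl hx1.ne')
  refine (h1.mul h2).congr_deriv ?_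
  simp only [id]
  rw [Real.rpow_sub_one hx0.ne', Real.rpow_sub_one hx1.ne' (γ - (α + β).re - 1),
    linearCoefficient_eval, hypergeometricLeading_eval, hypergeometricWronskian]
  field_simp
  ring

open Polynomial in
theorem liouvilleInvariant_kummer (a b w : ℝ) :
    liouvilleInvariant X (linearCoefficient b w) (a * w) =
      C (-(w ^ 2 / 4)) * X ^ 2 + C (b * w / 2 - a * w) * X + C (b / 2 - b ^ 2 / 4) := by
  refine Polynomial.funext fun x => ?_
  rw [liouvilleInvariant_eval, derivative_linearCoefficient, linearCoefficient_eval]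
  simp
  ring

open Polynomial in
theorem liouvilleInvariant_hypergeometric (γ s m : ℝ) :
    liouvilleInvariant hypergeometricLeading (linearCoefficient γ s) m =
      C (m + s / 2 - s ^ 2 / 4) * X ^ 2 + C (-m - γ + γ * s / 2) * X + C (γ / 2 - γ ^ 2 / 4) := by
  refine Polynomial.funext fun x => ?_
  rw [liouvilleInvariant_eval, derivative_linearCoefficient, linearCoefficient_eval]
  simp [hypergeometricLeading]
  ring

/-! ### Realizing polynomials as Liouville invariants -/

theorem Polynomial.eval_eq_of_natDegree_le_two {R : Polynomial ℝ} (h : R.natDegree ≤ 2)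
    (x : ℝ) : R.eval x = R.coeff 2 * x ^ 2 + R.coeff 1 * x + R.coeff 0 := by
  rw [Polynomial.eval_eq_sum_range' (Nat.lt_succ_of_le h)]
  simp [Finset.sum_range_succ]
  ring

theorem Polynomial.eval_nonneg_of_pos_on {R : Polynomial ℝ} {I : Set ℝ}
    (h : ∀ x ∈ I, 0 < R.eval x) {x : ℝ} (hx : x ∈ closure I) : 0 ≤ R.eval x :=
  closure_minimal (fun t ht => (h t ht).le) (isClosed_le continuous_const R.continuous) hx

open Polynomial in
theorem coeff_zero_nonneg_of_pos {r₀ r₁ r₂ : ℝ} (h : ∀ x > 0, 0 < r₂ * x ^ 2 + r₁ * x + r₀) :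
    0 ≤ r₀ := by
  have := Polynomial.eval_nonneg_of_pos_on (R := C r₂ * X ^ 2 + C r₁ * X + C r₀) (I := Ioi 0)
    (fun x hx => by simpa using h x hx) (x := 0) (by simp)
  simpa using this

theorem coeff_two_nonneg_of_pos {r₀ r₁ r₂ : ℝ} (h : ∀ x > 0, 0 < r₂ * x ^ 2 + r₁ * x + r₀) :
    0 ≤ r₂ := by
  refine coeff_zero_nonneg_of_pos (r₁ := r₁) (r₂ := r₀) fun x hx => ?_
  have h1 : r₀ * x ^ 2 + r₁ * x + r₂ = x ^ 2 * (r₂ * x⁻¹ ^ 2 + r₁ * x⁻¹ + r₀) := by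
    field_simp
    ring
  rw [h1]
  exact mul_pos (by positivity) (h _ (inv_pos.2 hx))

/-- The constants `b / 2 - b² / 4` are exactly the numbers `t ≤ 1 / 4`, and they remain so when
decreased. -/
theorem exists_half_sub_sq_div_four_eq (b : ℝ) {c : ℝ} (hc : 0 ≤ c) :
    ∃ b₁ : ℝ, b₁ / 2 - b₁ ^ 2 / 4 = b / 2 - b ^ 2 / 4 - c := by
  refine ⟨1 + √((b - 1) ^ 2 + 4 * c), ?_⟩
  have := Real.sq_sqrt (show 0 ≤ (b - 1) ^ 2 + 4 * c by positivity)
  linear_combination -(1 / 4) * this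

/-- Which polynomials are Liouville invariants of Kummer equations: for `w = 0` the coefficient of
`x` vanishes as well, which accounts for the last hypothesis. -/
theorem exists_kummer_parameters (a b w : ℝ) {r₀ r₁ r₂ c : ℝ} (hc : 0 ≤ c) (hr₀ : 0 ≤ r₀)
    (hr₂ : 0 ≤ r₂) (h : w = 0 → r₂ = 0 → r₁ = 0) :
    ∃ a₁ b₁ w₁ : ℝ, -(w₁ ^ 2 / 4) = -(w ^ 2 / 4) - c * r₂ ∧
      b₁ * w₁ / 2 - a₁ * w₁ = b * w / 2 - a * w - c * r₁ ∧
      b₁ / 2 - b₁ ^ 2 / 4 = b / 2 - b ^ 2 / 4 - c * r₀ := by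
  obtain ⟨b₁, hb₁⟩ := exists_half_sub_sq_div_four_eq b (mul_nonneg hc hr₀)
  have hw := Real.sq_sqrt (show 0 ≤ w ^ 2 + 4 * (c * r₂) by positivity)
  set w₁ := √(w ^ 2 + 4 * (c * r₂))
  rcases eq_or_ne w₁ 0 with h0 | h0
  · have hs : w ^ 2 + 4 * (c * r₂) = 0 := by rw [← hw, h0]; ring
    have hcr : 0 ≤ c * r₂ := mul_nonneg hc hr₂
    have hw0 : w = 0 := by
      have : w ^ 2 = 0 := le_antisymm (by linarith) (sq_nonneg w)
      simpa using this
    have hcr0 : c * r₂ = 0 := le_antisymm (by linarith [sq_nonneg w]) hcr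
    have hcr1 : c * r₁ = 0 := by
      rcases mul_eq_zero.1 hcr0 with h1 | h1
      · rw [h1, zero_mul]
      · rw [h hw0 h1, mul_zero]
    exact ⟨0, b₁, 0, by rw [hw0, hcr0]; ring, by rw [hw0, hcr1]; ring, hb₁⟩
  · refine ⟨(b₁ * w₁ / 2 - (b * w / 2 - a * w - c * r₁)) / w₁, b₁, w₁, ?_, ?_, hb₁⟩
    · linear_combination -(1 / 4) * hw
    · field_simp
      ring

theorem exists_realCoefficients (S P : ℝ) :
    ∃ α β : ℂ, RealCoefficients α β ∧ (α + β).re = S ∧ (α * β).re = P := by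
  obtain ⟨δ, hδ⟩ := IsAlgClosed.exists_pow_nat_eq ((S ^ 2 - 4 * P : ℝ) : ℂ) two_pos
  have h1 : ((S : ℂ) + δ) / 2 + ((S : ℂ) - δ) / 2 = (S : ℂ) := by ring
  have h2 : ((S : ℂ) + δ) / 2 * (((S : ℂ) - δ) / 2) = (P : ℂ) := by
    push_cast at hδ
    linear_combination -(1 / 4) * hδ
  refine ⟨((S : ℂ) + δ) / 2, ((S : ℂ) - δ) / 2, ⟨?_, ?_⟩, ?_, ?_⟩
  · rw [h1, Complex.ofReal_im]
  · rw [h2, Complex.ofReal_im]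
  · rw [h1, Complex.ofReal_re]
  · rw [h2, Complex.ofReal_re]

/-- The polynomials `t` of degree at most two with `t(0) ≤ 1 / 4` and `t(1) ≤ 1 / 4` are Liouville
invariants of hypergeometric equations; the two conditions fix the exponents at `0` and `1`. -/
theorem exists_hypergeometric_parameters (γ s m : ℝ) {r₀ r₁ r₂ c : ℝ} (hc : 0 ≤ c) (hr₀ : 0 ≤ r₀)
    (hr : 0 ≤ r₂ + r₁ + r₀) :
    ∃ γ₁ s₁ m₁ : ℝ, m₁ + s₁ / 2 - s₁ ^ 2 / 4 = m + s / 2 - s ^ 2 / 4 - c * r₂ ∧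
      -m₁ - γ₁ + γ₁ * s₁ / 2 = -m - γ + γ * s / 2 - c * r₁ ∧
      γ₁ / 2 - γ₁ ^ 2 / 4 = γ / 2 - γ ^ 2 / 4 - c * r₀ := by
  obtain ⟨γ₁, hγ₁⟩ := exists_half_sub_sq_div_four_eq γ (mul_nonneg hc hr₀)
  obtain ⟨δ₁, hδ₁⟩ := exists_half_sub_sq_div_four_eq (s - γ) (mul_nonneg hc hr)
  refine ⟨γ₁, γ₁ + δ₁, m + s / 2 - s ^ 2 / 4 - c * r₂ - (γ₁ + δ₁) / 2 + (γ₁ + δ₁) ^ 2 / 4,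
    by ring, ?_, hγ₁⟩
  linear_combination hδ₁ - hγ₁

/-! ### Sufficiency of the volatility form -/

/-- For `w = 0` the substitution `x = z²` turns solutions of the Kummer equation into solutions of
a Kummer equation. -/
theorem IsScaledKummerSolution.comp_sq {a b : ℝ} {F : ℝ → ℝ}
    (hF : IsScaledKummerSolution a b 0 F) :
    IsScaledKummerSolution a (2 * b - 1) 0 (fun z => F (z ^ 2)) := by
  have hsq : ∀ z ∈ Ioi (0 : ℝ), z ^ 2 ∈ Ioi (0 : ℝ) := fun z (hz : 0 < z) => pow_pos hz 2
  have d : ∀ z : ℝ, HasDerivAt (fun z : ℝ => z ^ 2) (2 * z) z := fun z => by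
    simpa using hasDerivAt_pow 2 z
  rw [isScaledKummerSolution_iff]
  refine .of_hasDerivAt isOpen_Ioi (fun x hx => by rw [Polynomial.eval_X]; exact hx)
    (G := fun z => deriv F (z ^ 2) * (2 * z))
    (H := fun z => deriv (deriv F) (z ^ 2) * (2 * z) * (2 * z) + deriv F (z ^ 2) * 2)
    (fun z hz => ?_) (fun z hz => ?_) fun z hz => ?_
  · exact HasDerivAt.comp (h := fun z : ℝ => z ^ 2) z
      (hF.1.hasDerivAt_deriv isOpen_Ioi (hsq z hz)).1 (d z)
  · have h1 := HasDerivAt.comp (h := fun z : ℝ => z ^ 2) z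
      (hF.1.hasDerivAt_deriv isOpen_Ioi (hsq z hz)).2 (d z)
    have h2 : HasDerivAt (fun z : ℝ => 2 * z) 2 z := by
      simpa using (hasDerivAt_id z).const_mul 2
    exact h1.mul h2
  · have e := hF.2 (z ^ 2) (hsq z hz)
    rw [linearCoefficient_eval, Polynomial.eval_X]
    linear_combination 4 * z * e

theorem IsChangeOfVariables.comp_sq {y : ℝ → ℝ} {J : Set ℝ}
    (hy : IsChangeOfVariables y (Ioi 0) J) :
    IsChangeOfVariables (fun z => y (z ^ 2)) (Ioi 0) J := by
  have hsq : MapsTo (fun z : ℝ => z ^ 2) (Ioi 0) (Ioi 0) := fun z (hz : 0 < z) => pow_pos hz 2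
  have hbij : BijOn (fun z : ℝ => z ^ 2) (Ioi 0) (Ioi 0) := by
    refine ⟨hsq, fun x hx z hz h => ?_, fun x hx => ⟨√x, Real.sqrt_pos.2 hx, ?_⟩⟩
    · exact (pow_left_inj₀ (le_of_lt hx) (le_of_lt hz) two_ne_zero).1 h
    · exact Real.sq_sqrt (le_of_lt hx)
  refine ⟨hy.1.comp hbij, hy.2.1.comp (contDiff_id.pow 2).contDiffOn hsq, fun z hz => ?_⟩
  have d : HasDerivAt (fun z : ℝ => z ^ 2) (2 * z) z := by simpa using hasDerivAt_pow 2 z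
  have h1 := HasDerivAt.comp (h := fun z : ℝ => z ^ 2) z (hy.hasDerivAt isOpen_Ioi (hsq hz)) d
  change deriv (y ∘ fun z : ℝ => z ^ 2) z ≠ 0
  rw [h1.deriv]
  exact mul_ne_zero (hy.2.2 _ (hsq hz)) (mul_ne_zero two_ne_zero (ne_of_gt hz))

namespace DriftlessDiffusion

open Polynomial in
/-- The confluent case of sufficiency, away from the situation `w = 0`, `R = r₁ x + r₀`, `r₁ ≠ 0`,
in which the eigenfunction equations with `lam > 0` are not Kummer equations in the variable `x`. -/
theorem isConfluentSolvable_of_volatility (Y : DriftlessDiffusion) {a b w r₀ r₁ r₂ : ℝ}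
    {c₁ c₂ c₃ c₄ K : ℝ} {F₁ F₂ : ℝ → ℝ} (hF₁ : IsScaledKummerSolution a b w F₁)
    (hF₂ : IsScaledKummerSolution a b w F₂) (hdeg : w = 0 → r₂ = 0 → r₁ = 0)
    (hden : ∀ x ∈ Ioi 0, c₁ * F₁ x + c₂ * F₂ x ≠ 0)
    (hy : IsChangeOfVariables
      (fun x => (c₃ * F₁ x + c₄ * F₂ x) / (c₁ * F₁ x + c₂ * F₂ x)) (Ioi 0) Y.D)
    (hσ : ∀ x ∈ Ioi 0, Y.σ ((c₃ * F₁ x + c₄ * F₂ x) / (c₁ * F₁ x + c₂ * F₂ x)) =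
      K * √x * (kummerWronskian b w x / (c₁ * F₁ x + c₂ * F₂ x) ^ 2) *
        √(x / (r₂ * x ^ 2 + r₁ * x + r₀))) : Y.IsConfluentSolvable := by
  obtain ⟨hR, κ, hκ, H⟩ := Y.exists_gauge_of_volatility (A := X)
    (R := C r₂ * X ^ 2 + C r₁ * X + C r₀) isOpen_Ioi isPreconnected_Ioi
    (fun x hx => by rw [eval_X]; exact hx) (isWronskianOn_kummerWronskian b w)
    (isScaledKummerSolution_iff.1 hF₁) (isScaledKummerSolution_iff.1 hF₂) hden hy
    (fun x hx => by simpa using hσ x hx)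
  have hR' : ∀ x > 0, 0 < r₂ * x ^ 2 + r₁ * x + r₀ := fun x hx => by simpa using hR x hx
  have key : ∀ lam : ℝ, ∃ h : ℝ → ℝ, 0 ≤ lam → (∀ z ∈ Ioi (0 : ℝ), h z ≠ 0) ∧
      ∃ a b w : ℝ, ∀ f : ℝ → ℝ, Y.IsEigenfunction lam f →
        ∃ F : ℝ → ℝ, IsScaledKummerSolution a b w F ∧ ∀ z ∈ Ioi (0 : ℝ),
          f ((c₃ * F₁ z + c₄ * F₂ z) / (c₁ * F₁ z + c₂ * F₂ z)) = h z * F z := by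
    intro lam
    by_cases hl : 0 ≤ lam
    · obtain ⟨a', b', w', e₂, e₁, e₀⟩ := exists_kummer_parameters a b w
        (mul_nonneg hl hκ.le) (coeff_zero_nonneg_of_pos hR') (coeff_two_nonneg_of_pos hR') hdeg
      obtain ⟨h, hh, hf⟩ := H lam _ (a' * w') _ (isWronskianOn_kummerWronskian b' w') (by
        rw [liouvilleInvariant_kummer, liouvilleInvariant_kummer, e₂, e₁, e₀]
        simp only [C_sub, C_mul]
        ring)
      refine ⟨h, fun _ => ⟨hh, a', b', w', fun f hfe => ?_⟩⟩
      obtain ⟨F, hF, e⟩ := hf f hfe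
      exact ⟨F, isScaledKummerSolution_iff.2 hF, e⟩
    · exact ⟨0, fun h => absurd h hl⟩
  choose h hh using key
  exact ⟨_, fun z lam => h lam z, hy, hh⟩

theorem isConfluentSolvable_of_hasVolatilityForm (Y : DriftlessDiffusion) {a b w : ℝ}
    {F₁ F₂ : ℝ → ℝ} (hF₁ : IsScaledKummerSolution a b w F₁)
    (hF₂ : IsScaledKummerSolution a b w F₂)
    (h : Y.HasVolatilityForm (Ioi 0) (fun x => x) (kummerWronskian b w) F₁ F₂) :
    Y.IsConfluentSolvable := by
  obtain ⟨R, K, c₁, c₂, c₃, c₄, hdeg, -, -, hden, hy, hσ⟩ := h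
  simp only [Polynomial.eval_eq_of_natDegree_le_two hdeg] at hσ
  by_cases hd : w = 0 → R.coeff 2 = 0 → R.coeff 1 = 0
  · exact Y.isConfluentSolvable_of_volatility hF₁ hF₂ hd hden hy hσ
  · push Not at hd
    obtain ⟨rfl, h2, -⟩ := hd
    -- The equations for `lam > 0` are Bessel equations in `√x` here. With `x = z²`, the parameter
    -- `b` becomes `2 b - 1`, `w` remains `0`, and `R` becomes `r₁ z² + r₀`.
    refine Y.isConfluentSolvable_of_volatility (r₂ := R.coeff 1) (r₁ := 0) (r₀ := R.coeff 0)
      (K := K) hF₁.comp_sq hF₂.comp_sq (fun _ _ => rfl) (fun z (hz : 0 < z) => hden _ (pow_pos hz 2))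
      hy.comp_sq fun z (hz : 0 < z) => ?_
    rw [hσ (z ^ 2) (pow_pos hz 2), h2, zero_mul, zero_mul, zero_add, add_zero]
    have e1 : kummerWronskian (2 * b - 1) 0 z = z * kummerWronskian b 0 (z ^ 2) := by
      rw [kummerWronskian, kummerWronskian, ← Real.rpow_natCast z 2, ← Real.rpow_mul hz.le,
        show -(2 * b - 1) = 1 + ((2 : ℕ) : ℝ) * -b by push_cast; ring, Real.rpow_add hz,
        Real.rpow_one]
      simp
    have e2 : √(z ^ 2 / (R.coeff 1 * z ^ 2 + R.coeff 0)) =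
        √z * √(z / (R.coeff 1 * z ^ 2 + R.coeff 0)) := by
      rw [← Real.sqrt_mul hz.le]
      congr 1
      ring
    rw [e1, e2, Real.sqrt_sq hz.le]
    ring

open Polynomial in
theorem isHypergeometricSolvable_of_hasVolatilityForm (Y : DriftlessDiffusion) {α β : ℂ} {γ : ℝ}
    {F₁ F₂ : ℝ → ℝ} (hF₁ : IsHypergeometricSolution α β γ F₁)
    (hF₂ : IsHypergeometricSolution α β γ F₂)
    (h : Y.HasVolatilityForm (Ioo 0 1) (fun x => x * (1 - x)) (hypergeometricWronskian α β γ)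
      F₁ F₂) : Y.IsHypergeometricSolvable := by
  obtain ⟨R, K, c₁, c₂, c₃, c₄, hdeg, -, -, hden, hy, hσ⟩ := h
  obtain ⟨hR, κ, hκ, H⟩ := Y.exists_gauge_of_volatility (R := R) isOpen_Ioo isPreconnected_Ioo
    hypergeometricLeading_eval_pos (isWronskianOn_hypergeometricWronskian α β γ)
    (isHypergeometricSolution_iff.1 hF₁) (isHypergeometricSolution_iff.1 hF₂) hden hy
    (fun x hx => by rw [hypergeometricLeading_eval]; exact hσ x hx)
  have hR₀ : 0 ≤ R.coeff 0 := by
    have := Polynomial.eval_nonneg_of_pos_on hR (x := 0) (by simp)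
    simpa [Polynomial.eval_eq_of_natDegree_le_two hdeg] using this
  have hR₁ : 0 ≤ R.coeff 2 + R.coeff 1 + R.coeff 0 := by
    have := Polynomial.eval_nonneg_of_pos_on hR (x := 1) (by simp)
    simpa [Polynomial.eval_eq_of_natDegree_le_two hdeg] using this
  have hReq : R = C (R.coeff 2) * X ^ 2 + C (R.coeff 1) * X + C (R.coeff 0) :=
    Polynomial.funext fun x => by
      rw [Polynomial.eval_eq_of_natDegree_le_two hdeg]
      simp
  have key : ∀ lam : ℝ, ∃ h : ℝ → ℝ, 0 ≤ lam → (∀ z ∈ Ioo (0 : ℝ) 1, h z ≠ 0) ∧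
      ∃ (α β : ℂ) (γ : ℝ), RealCoefficients α β ∧ ∀ f : ℝ → ℝ, Y.IsEigenfunction lam f →
        ∃ F : ℝ → ℝ, IsHypergeometricSolution α β γ F ∧ ∀ z ∈ Ioo (0 : ℝ) 1,
          f ((c₃ * F₁ z + c₄ * F₂ z) / (c₁ * F₁ z + c₂ * F₂ z)) = h z * F z := by
    intro lam
    by_cases hl : 0 ≤ lam
    · obtain ⟨γ', s', m', e₂, e₁, e₀⟩ := exists_hypergeometric_parameters γ
        (1 + (α + β).re) (α * β).re (mul_nonneg hl hκ.le) hR₀ hR₁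
      obtain ⟨α', β', hre, hS, hP⟩ := exists_realCoefficients (s' - 1) m'
      obtain ⟨h, hh, hf⟩ := H lam _ (α' * β').re _
        (isWronskianOn_hypergeometricWronskian α' β' γ') (by
        rw [liouvilleInvariant_hypergeometric, liouvilleInvariant_hypergeometric, hS, hP,
          add_sub_cancel, e₂, e₁, e₀]
        conv_rhs => rw [hReq]
        simp only [C_sub, C_mul]
        ring)
      refine ⟨h, fun _ => ⟨hh, α', β', γ', hre, fun f hfe => ?_⟩⟩
      obtain ⟨F, hF, e⟩ := hf f hfe
      exact ⟨F, isHypergeometricSolution_iff.2 hF, e⟩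
    · exact ⟨0, fun h => absurd h hl⟩
  choose h hh using key
  exact ⟨_, fun z lam => h lam z, hy, hh⟩

end DriftlessDiffusion

theorem theorem5p1 (Y : DriftlessDiffusion) :
    Y.IsSolvable ↔
      (∃ (a b w : ℝ) (F₁ F₂ : ℝ → ℝ),
        IsScaledKummerSolution a b w F₁ ∧ IsScaledKummerSolution a b w F₂ ∧
        LinIndepOn (Ioi 0) F₁ F₂ ∧
        Y.HasVolatilityForm (Ioi 0) (fun x => x) (kummerWronskian b w) F₁ F₂) ∨
      (∃ (α β : ℂ) (γ : ℝ) (F₁ F₂ : ℝ → ℝ), RealCoefficients α β ∧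
        IsHypergeometricSolution α β γ F₁ ∧ IsHypergeometricSolution α β γ F₂ ∧
        LinIndepOn (Ioo 0 1) F₁ F₂ ∧
        Y.HasVolatilityForm (Ioo 0 1) (fun x => x * (1 - x))
          (hypergeometricWronskian α β γ) F₁ F₂) := by
  refine or_congr ⟨?_, ?_⟩ ⟨?_, ?_⟩
  · rintro ⟨y, h, hy, H⟩
    obtain ⟨-, a, b, w, H₀⟩ := H 0 le_rfl
    obtain ⟨-, a', b', w', H₁⟩ := H 1 zero_le_one
    simp only [isScaledKummerSolution_iff] at H₀ H₁
    obtain ⟨F₁, F₂, hF₁, hF₂, hind, hvol⟩ := Y.exists_hasVolatilityForm_of_gauge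
      (h₀ := fun z => h z 0) (h₁ := fun z => h z 1) isOpen_Ioi isPreconnected_Ioi
      (Polynomial.natDegree_X_le.trans one_le_two) (natDegree_linearCoefficient_le b w)
      (natDegree_linearCoefficient_le b' w') (fun x hx => by rw [Polynomial.eval_X]; exact hx)
      (isWronskianOn_kummerWronskian b w) hy H₀ H₁
    simp only [Polynomial.eval_X] at hvol
    exact ⟨a, b, w, F₁, F₂, isScaledKummerSolution_iff.2 hF₁, isScaledKummerSolution_iff.2 hF₂,
      hind, hvol⟩
  · rintro ⟨a, b, w, F₁, F₂, hF₁, hF₂, -, h⟩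
    exact Y.isConfluentSolvable_of_hasVolatilityForm hF₁ hF₂ h
  · rintro ⟨y, h, hy, H⟩
    obtain ⟨-, α, β, γ, hre, H₀⟩ := H 0 le_rfl
    obtain ⟨-, α', β', γ', -, H₁⟩ := H 1 zero_le_one
    simp only [isHypergeometricSolution_iff] at H₀ H₁
    obtain ⟨F₁, F₂, hF₁, hF₂, hind, hvol⟩ := Y.exists_hasVolatilityForm_of_gauge
      (h₀ := fun z => h z 0) (h₁ := fun z => h z 1) isOpen_Ioo isPreconnected_Ioo
      natDegree_hypergeometricLeading_le (natDegree_linearCoefficient_le _ _)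
      (natDegree_linearCoefficient_le _ _) hypergeometricLeading_eval_pos
      (isWronskianOn_hypergeometricWronskian α β γ) hy H₀ H₁
    simp only [hypergeometricLeading_eval] at hvol
    exact ⟨α, β, γ, F₁, F₂, hre, isHypergeometricSolution_iff.2 hF₁,
      isHypergeometricSolution_iff.2 hF₂, hind, hvol⟩
  · rintro ⟨α, β, γ, F₁, F₂, -, hF₁, hF₂, -, h⟩
    exact Y.isHypergeometricSolvable_of_hasVolatilityForm hF₁ hF₂ h
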